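/- Let $P(\varphi,\theta)=(\cos\varphi\cos\theta,\cos\varphi\sin\theta,\sin\varphi)\in\mathbb{R}^3$. For $x=(\phi_1,\phi_2,\theta_2,\phi_3,\theta_3,\phi_4,\theta_4)\in\mathbb{R}^7$ let $f(x)$ be the sum of the ten mutual Euclidean distances of the five points $A=P(0,0)$, $B=P(\phi_1,\pi)$, $C=P(\phi_2,\theta_2)$, $D=P(\phi_3,\theta_3)$, $E=P(\phi_4,\theta_4)$ of the unit sphere. Let $$\Theta_{bp}=\left(-\tfrac{\pi}{3},\tfrac{\pi}{3},\pi,0,-\tfrac{\pi}{2},0,\tfrac{\pi}{2}\right),\qquad fmax=f(\Theta_{bp})$$ be the coordinates and the distance sum of the bipyramid configuration, and let $\mathcal{D}_{bp}\subset\mathbb{R}^7$ be the rational box $$\begin{aligned}\mathcal{D}_{bp}=&\left[-\tfrac{1055530689}{1000000000},-\tfrac{1038864413}{1000000000}\right]\\ &\times\left[\tfrac{1038864413}{1000000000},\tfrac{1055530689}{1000000000}\right]\\ &\times\left[\tfrac{783314879}{250000000},\tfrac{98435181}{31250000}\right]\\ &\times\left[-\tfrac{10416421265218147343}{1250000000000000000000},\tfrac{10416421265218147343}{1250000000000000000000}\right]\\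 &\times\left[-\tfrac{315825893}{200000000},-\tfrac{1562463189}{1000000000}\right]\\ &\times\left[-\tfrac{10416421265218147343}{1250000000000000000000},\tfrac{10416421265218147343}{1250000000000000000000}\right]\\ &\times\left[\tfrac{1562463189}{1000000000},\tfrac{315825893}{200000000}\right].\end{aligned}$$ Let $\mathcal{V}$ be the set of all symmetric real $7\times7$ matrices whose $(i,j)$ entry lies in $V_{ij}$ for all $i,j$, where $V_{ji}=V_{ij}$ and $$\begin{array}{l}V_{11}=[-0.9073071021,-0.8252401824],\ V_{12}=[0.4158136493,0.4505611684],\ V_{13}=[-0.002503191333,0.002503191333],\ V_{14}=[-0.3643559852,-0.3428082152],\ V_{15}=[0.6038013477,0.6209532484],\ V_{16}=[-0.364355985,-0.3428082155],\ V_{17}=[-0.6209532486,-0.6038013477],\\ V_{22}=[-0.9135297804,-0.8191611957],\ V_{23}=[-0.02990646144,0.02990646124],\ V_{24}=[-0.3674804384,-0.3397366803],\ V_{25}=[-0.6236253388,-0.6011315925],\ V_{26}=[-0.367480438,-0.3397366808],\ V_{27}=[0.6011315931,0.6236253384],\\ V_{33}=[-0.3523502821,-0.2901860369],\ V_{34}=[-0.1628135751,-0.1436235052],\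 V_{35}=[0.07781239645,0.09916175537],\ V_{36}=[0.1436235054,0.1628135749],\ V_{37}=[0.07781239691,0.09916175492],\\ V_{44}=[-1.071924605,-0.9891691177],\ V_{45}=[-0.02419958285,0.02428832075],\ V_{46}=[-0.50006945,-0.4999305593],\ V_{47}=[-0.0001041678267,0.0001041678267],\\ V_{55}=[-1.058713931,-1.002296947],\ V_{56}=[-0.0001041678267,0.0001041678267],\ V_{57}=[0.4998958448,0.5000694476],\\ V_{66}=[-1.071924603,-0.9891691196],\ V_{67}=[-0.02428832044,0.02419958264],\\ V_{77}=[-1.058713929,-1.00229695].\end{array}$$ Then: 1. every $x\in\mathbb{R}^7$ all of whose coordinates differ from those of $\Theta_{bp}$ by at most $\pi/377$ lies in $\mathcal{D}_{bp}$; 2. $f$ is $C^2$ near every point of $\mathcal{D}_{bp}$, and at every point of $\mathcal{D}_{bp}$ the Hessian matrix of $f$ belongs to $\mathcal{V}$; 3. every matrix in $\mathcal{V}$ is negative definite; 4. $\Theta_{bp}\in\mathcal{D}_{bp}$, and $f(x)\le fmax$ for every $x\in\mathcal{D}_{bp}$, with equality if and only if $x=\Theta_{bp}$; 5. $fmax=3\sqrt3+6\sqrt2+2$.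 -/

import Mathlib

/-! Sum of mutual distances of five points on the unit sphere. -/

namespace FivePoints

noncomputable section

/-- The point of the unit sphere with latitude `φ` and longitude `θ`. -/
def sph (φ θ : ℝ) : EuclideanSpace ℝ (Fin 3) :=
  !₂[Real.cos φ * Real.cos θ, Real.cos φ * Real.sin θ, Real.sin φ]

/-- The five points `A, B, C, D, E` with coordinate vector
`x = (φ₁, φ₂, θ₂, φ₃, θ₃, φ₄, θ₄)`. -/
def points (x : Fin 7 → ℝ) : Fin 5 → EuclideanSpace ℝ (Fin 3) :=
  ![sph 0 0, sph (x 0) Real.pi, sph (x 1) (x 2), sph (x 3) (x 4), sph (x 5) (x 6)]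

/-- The sum of the ten mutual distances of the five points. -/
def f (x : Fin 7 → ℝ) : ℝ :=
  ∑ i : Fin 5, ∑ j ∈ Finset.Ioi i, dist (points x i) (points x j)

/-- The bipyramid coordinates. -/
def thetaBp : Fin 7 → ℝ :=
  ![-(Real.pi / 3), Real.pi / 3, Real.pi, 0, -(Real.pi / 2), 0, Real.pi / 2]

/-- The distance sum of the bipyramid configuration. -/
def fmax : ℝ := f thetaBp

/-- Lower endpoints of the rational box. -/
def boxLower : Fin 7 → ℝ :=
  ![-1055530689 / 1000000000,
    1038864413 / 1000000000,
    783314879 / 250000000,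
    -10416421265218147343 / 1250000000000000000000,
    -315825893 / 200000000,
    -10416421265218147343 / 1250000000000000000000,
    1562463189 / 1000000000]

/-- Upper endpoints of the rational box. -/
def boxUpper : Fin 7 → ℝ :=
  ![-1038864413 / 1000000000,
    1055530689 / 1000000000,
    98435181 / 31250000,
    10416421265218147343 / 1250000000000000000000,
    -1562463189 / 1000000000,
    10416421265218147343 / 1250000000000000000000,
    315825893 / 200000000]

/-- The rational box around the bipyramid coordinates. -/
def Dbp : Set (Fin 7 → ℝ) := Set.Icc boxLower boxUpper

/-- The matrix of second partial derivatives `∂ᵢ ∂ⱼ g` at `x`. -/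
def hessian (g : (Fin 7 → ℝ) → ℝ) (x : Fin 7 → ℝ) : Matrix (Fin 7) (Fin 7) ℝ :=
  Matrix.of fun i j =>
    fderiv ℝ (fun y => fderiv ℝ g y (Pi.single j 1)) x (Pi.single i 1)

/-- The symmetric interval matrix `[L, U]`: all symmetric real matrices that lie
entrywise between `L` and `U`. -/
def symInterval {n : ℕ} (L U : Matrix (Fin n) (Fin n) ℝ) :
    Set (Matrix (Fin n) (Fin n) ℝ) :=
  {A | A.IsSymm ∧ ∀ i j, L i j ≤ A i j ∧ A i j ≤ U i j}

/-- A set of real matrices is negative definite if each of its members is. -/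
def IsNegDef {n : ℕ} (S : Set (Matrix (Fin n) (Fin n) ℝ)) : Prop :=
  ∀ A ∈ S, (-A).PosDef

/-- Lower endpoints of the interval Hessian matrix. -/
def hessLower : Matrix (Fin 7) (Fin 7) ℝ :=
  !![-9073071021 / 10000000000,
       4158136493 / 10000000000,
       -2503191333 / 1000000000000,
       -910889963 / 2500000000,
       6038013477 / 10000000000,
       -72871197 / 200000000,
       -3104766243 / 5000000000;
     4158136493 / 10000000000,
       -2283824451 / 2500000000,
       -23364423 / 781250000,
       -114837637 / 312500000,
       -1559063347 / 2500000000,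
       -183740219 / 500000000,
       6011315931 / 10000000000;
     -2503191333 / 1000000000000,
       -23364423 / 781250000,
       -3523502821 / 10000000000,
       -1628135751 / 10000000000,
       1556247929 / 20000000000,
       718117527 / 5000000000,
       7781239691 / 100000000000;
     -910889963 / 2500000000,
       -114837637 / 312500000,
       -1628135751 / 10000000000,
       -214384921 / 200000000,
       -483991657 / 20000000000,
       -10001389 / 20000000,
       -1041678267 / 10000000000000;
     6038013477 / 10000000000,
       -1559063347 / 2500000000,
       1556247929 / 20000000000,
       -483991657 / 20000000000,
       -1058713931 / 1000000000,
       -1041678267 / 10000000000000,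
       312434903 / 625000000;
     -72871197 / 200000000,
       -183740219 / 500000000,
       718117527 / 5000000000,
       -10001389 / 20000000,
       -1041678267 / 10000000000000,
       -1071924603 / 1000000000,
       -607208011 / 25000000000;
     -3104766243 / 5000000000,
       6011315931 / 10000000000,
       7781239691 / 100000000000,
       -1041678267 / 10000000000000,
       312434903 / 625000000,
       -607208011 / 25000000000,
       -1058713929 / 1000000000]

/-- Upper endpoints of the interval Hessian matrix. -/
def hessUpper : Matrix (Fin 7) (Fin 7) ℝ :=
  !![-257887557 / 312500000,
       1126402921 / 2500000000,
       2503191333 / 1000000000000,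
       -428510269 / 1250000000,
       1552383121 / 2500000000,
       -685616431 / 2000000000,
       -6038013477 / 10000000000;
     1126402921 / 2500000000,
       -8191611957 / 10000000000,
       747661531 / 25000000000,
       -3397366803 / 10000000000,
       -240452637 / 400000000,
       -424670851 / 1250000000,
       779531673 / 1250000000;
     2503191333 / 1000000000000,
       747661531 / 25000000000,
       -2901860369 / 10000000000,
       -359058763 / 2500000000,
       9916175537 / 100000000000,
       1628135749 / 10000000000,
       2479043873 / 25000000000;
     -428510269 / 1250000000,
       -3397366803 / 10000000000,
       -359058763 / 2500000000,
       -9891691177 / 10000000000,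
       97153283 / 4000000000,
       -4999305593 / 10000000000,
       1041678267 / 10000000000000;
     1552383121 / 2500000000,
       -240452637 / 400000000,
       9916175537 / 100000000000,
       97153283 / 4000000000,
       -1002296947 / 1000000000,
       1041678267 / 10000000000000,
       1250173619 / 2500000000;
     -685616431 / 2000000000,
       -424670851 / 1250000000,
       1628135749 / 10000000000,
       -4999305593 / 10000000000,
       1041678267 / 10000000000000,
       -2472922799 / 2500000000,
       302494783 / 12500000000;
     -6038013477 / 10000000000,
       779531673 / 1250000000,
       2479043873 / 25000000000,
       1041678267 / 10000000000000,
       1250173619 / 2500000000,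
       302494783 / 12500000000,
       -20045939 / 20000000]

/-- The interval Hessian matrix of `f` over the box. -/
def intervalHessian : Set (Matrix (Fin 7) (Fin 7) ℝ) := symInterval hessLower hessUpper

/-- The distance sum written out in the coordinates. -/
theorem f_eq (x : Fin 7 → ℝ) :
    f x = √(2 + 2 * Real.cos (x 0))
      + √(2 - 2 * Real.cos (x 1) * Real.cos (x 2))
      + √(2 - 2 * Real.cos (x 3) * Real.cos (x 4))
      + √(2 - 2 * Real.cos (x 5) * Real.cos (x 6))
      + √(2 * Real.cos (x 0) * Real.cos (x 1) * Real.cos (x 2) + 2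
          - 2 * Real.sin (x 0) * Real.sin (x 1))
      + √(2 * Real.cos (x 0) * Real.cos (x 3) * Real.cos (x 4) + 2
          - 2 * Real.sin (x 0) * Real.sin (x 3))
      + √(2 * Real.cos (x 0) * Real.cos (x 5) * Real.cos (x 6) + 2
          - 2 * Real.sin (x 0) * Real.sin (x 5))
      + √(-2 * Real.cos (x 3) * Real.cos (x 1) * Real.cos (x 2 - x 4) + 2
          - 2 * Real.sin (x 1) * Real.sin (x 3))
      + √(-2 * Real.cos (x 1) * Real.cos (x 5) * Real.cos (x 2 - x 6) + 2
          - 2 * Real.sin (x 1) * Real.sin (x 5))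
      + √(-2 * Real.cos (x 3) * Real.cos (x 5) * Real.cos (x 4 - x 6) + 2
          - 2 * Real.sin (x 3) * Real.sin (x 5)) := by
  have key : ∀ a b c d : ℝ, dist (sph a b) (sph c d)
      = √(2 - 2 * (Real.cos a * Real.cos c * Real.cos (b - d)
          + Real.sin a * Real.sin c)) := by
    intro a b c d
    rw [EuclideanSpace.dist_eq]
    congr 1
    simp only [sph, Fin.sum_univ_three, Real.dist_eq, sq_abs]
    simp only [Matrix.cons_val]
    rw [Real.cos_sub]
    have h1 := Real.sin_sq_add_cos_sq a
    have h2 := Real.sin_sq_add_cos_sq b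
    have h3 := Real.sin_sq_add_cos_sq c
    have h4 := Real.sin_sq_add_cos_sq d
    linear_combination (Real.cos a) ^ 2 * h2 + (Real.cos c) ^ 2 * h4 + h1 + h3
  have e0 : Finset.Ioi (0 : Fin 5) = {1, 2, 3, 4} := by decide
  have e1 : Finset.Ioi (1 : Fin 5) = {2, 3, 4} := by decide
  have e2 : Finset.Ioi (2 : Fin 5) = {3, 4} := by decide
  have e3 : Finset.Ioi (3 : Fin 5) = {4} := by decide
  have e4 : Finset.Ioi (4 : Fin 5) = ∅ := by decide
  have hpi : ∀ t : ℝ, Real.cos (Real.pi - t) = -Real.cos t := Real.cos_pi_sub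
  rw [f, Fin.sum_univ_five, e0, e1, e2, e3, e4]
  simp [points, key, hpi]
  ring_nf

end

end FivePoints

/-!
The bipyramid configuration is the unique maximiser on the box because `f` is strictly concave
there in the second order sense: every Hessian matrix of `f` over the box lies in an interval
matrix all of whose members are negative definite. As the gradient vanishes at the bipyramid, `f`
decreases strictly along each segment of the box that starts there (`lt_of_hessian_negDef`).

*Derivatives.* `f` is a sum of ten distances, each of them the function `chord` of four
coordinates composed with an affine map (`f_eq_sum_chord`). With `u` the cosine of the angle at the
centre and `d = √(2 - 2u)` the distance, the second derivatives of `d` are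
`-∂ₛ∂ₜu / d - ∂ₛu ∂ₜu / d³`, and the Hessian matrix of `f` is the sum of these contributions
(`hessian_f_apply`).

*Enclosure of the Hessian matrix.* The entries are bounded by rational interval arithmetic, which is
evaluated in the kernel (`hessBox_check`). The prescribed intervals leave little room, so the second
derivatives are first rewritten, by means of `d² = 2 - 2u` and `sin² + cos² = 1`, in forms in which
the variables occur less often. For instance the second derivative in a latitude is
`-d / 4 + (cos c sin δ)² / d³`, where `c` is the latitude of the other point and `δ` the difference
of the longitudes. Where no single form is sharp for all ten pairs, the intervals obtained from two
of them are intersected (`ChordBox.Holds.hess`).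

*Negative definiteness.* On the vectors with a given sign pattern, the quadratic form of `-A`, for
`A` in the interval matrix, is bounded below by that of one vertex of the interval matrix, so it
suffices that the vertex matrices of all `2⁷` sign patterns are positive definite. The margin is
small (the least eigenvalue is of the order `10⁻⁴`), which rules out cruder criteria such as
diagonal dominance. After rounding to integers, positive definiteness is read off from the pivots of
fraction-free Gaussian elimination (`quadForm_pos_of_pivotsPos`, `pivotsPos_signVertex`).
-/

namespace FivePoints

/-! ### The distance of two points and its derivatives -/

noncomputable section

/-- The cosine of the angle at the centre between the points with latitudes `z 0`, `z 2` and
longitudes `z 1`, `z 3`. -/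
def cosAngle (z : Fin 4 → ℝ) : ℝ :=
  Real.cos (z 0) * Real.cos (z 2) * Real.cos (z 1 - z 3) + Real.sin (z 0) * Real.sin (z 2)

/-- The distance between the points with latitudes `z 0`, `z 2` and longitudes `z 1`, `z 3`. -/
def chord (z : Fin 4 → ℝ) : ℝ := √(2 - 2 * cosAngle z)

/-- The partial derivatives of `cosAngle`. -/
def cosAngleGrad (z : Fin 4 → ℝ) : Fin 4 → ℝ :=
  let a := z 0; let c := z 2; let δ := z 1 - z 3
  ![-(Real.sin a * Real.cos c * Real.cos δ) + Real.cos a * Real.sin c,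
    -(Real.cos a * Real.cos c * Real.sin δ),
    -(Real.cos a * Real.sin c * Real.cos δ) + Real.sin a * Real.cos c,
    Real.cos a * Real.cos c * Real.sin δ]

/-- The second partial derivatives of `cosAngle`. -/
def cosAngleHess (z : Fin 4 → ℝ) : Fin 4 → Fin 4 → ℝ :=
  let a := z 0; let c := z 2; let δ := z 1 - z 3
  let ac := Real.sin a * Real.sin c * Real.cos δ + Real.cos a * Real.cos c
  let ab := Real.sin a * Real.cos c * Real.sin δ
  let cb := Real.cos a * Real.sin c * Real.sin δ
  let bb := -(Real.cos a * Real.cos c * Real.cos δ)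
  ![![-cosAngle z, ab, ac, -ab], ![ab, bb, cb, -bb], ![ac, cb, -cosAngle z, -cb],
    ![-ab, -bb, -cb, bb]]

/-- The partial derivatives of `chord`. -/
def chordGrad (z : Fin 4 → ℝ) (s : Fin 4) : ℝ := -(cosAngleGrad z s * (chord z)⁻¹)

/-- The second partial derivatives of `chord`. -/
def chordHess (z : Fin 4 → ℝ) (s t : Fin 4) : ℝ :=
  -(cosAngleHess z s t * (chord z)⁻¹) - cosAngleGrad z s * cosAngleGrad z t * (chord z)⁻¹ ^ 3

/-- The linear functional with the coefficients `g`. -/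
def functional (g : Fin 4 → ℝ) : (Fin 4 → ℝ) →L[ℝ] ℝ :=
  ∑ s, g s • ContinuousLinearMap.proj (R := ℝ) (φ := fun _ : Fin 4 => ℝ) s

theorem functional_apply (g v : Fin 4 → ℝ) : functional g v = ∑ s, g s * v s := by
  simp [functional]

theorem hasFDerivAt_coord (z : Fin 4 → ℝ) (s : Fin 4) :
    HasFDerivAt (fun y : Fin 4 → ℝ => y s) (ContinuousLinearMap.proj (R := ℝ) s) z :=
  hasFDerivAt_apply s z

theorem hasFDerivAt_cosAngle (z : Fin 4 → ℝ) :
    HasFDerivAt cosAngle (functional (cosAngleGrad z)) z := by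
  have h0 := hasFDerivAt_coord z 0
  have h2 := hasFDerivAt_coord z 2
  have hd := (hasFDerivAt_coord z 1).sub (hasFDerivAt_coord z 3)
  refine (((h0.cos.mul h2.cos).mul hd.cos).add (h0.sin.mul h2.sin)).congr_fderiv ?_
  ext v
  simp [functional_apply, Fin.sum_univ_four, cosAngleGrad]
  ring

theorem hasFDerivAt_cosAngleGrad (z : Fin 4 → ℝ) (s : Fin 4) :
    HasFDerivAt (fun y => cosAngleGrad y s) (functional (cosAngleHess z s)) z := by
  have h0 := hasFDerivAt_coord z 0
  have h2 := hasFDerivAt_coord z 2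
  have hd := (hasFDerivAt_coord z 1).sub (hasFDerivAt_coord z 3)
  fin_cases s
  · refine ((((h0.sin.mul h2.cos).mul hd.cos).neg).add (h0.cos.mul h2.sin)).congr_fderiv ?_
    ext v
    simp [functional_apply, Fin.sum_univ_four, cosAngleHess, cosAngle]
    ring
  · refine (((h0.cos.mul h2.cos).mul hd.sin).neg).congr_fderiv ?_
    ext v
    simp [functional_apply, Fin.sum_univ_four, cosAngleHess, cosAngle]
    ring
  · refine ((((h0.cos.mul h2.sin).mul hd.cos).neg).add (h0.sin.mul h2.cos)).congr_fderiv ?_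
    ext v
    simp [functional_apply, Fin.sum_univ_four, cosAngleHess, cosAngle]
    ring
  · refine ((h0.cos.mul h2.cos).mul hd.sin).congr_fderiv ?_
    ext v
    simp [functional_apply, Fin.sum_univ_four, cosAngleHess, cosAngle]
    ring

theorem chord_pos {z : Fin 4 → ℝ} (hz : cosAngle z < 1) : 0 < chord z :=
  Real.sqrt_pos.2 (by linarith)

theorem hasFDerivAt_chord {z : Fin 4 → ℝ} (hz : cosAngle z < 1) :
    HasFDerivAt chord (functional (chordGrad z)) z := by
  have hp := chord_pos hz
  have h := (((hasFDerivAt_cosAngle z).const_mul 2).const_sub 2).sqrt (by linarith)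
  refine h.congr_fderiv ?_
  ext v
  simp only [smul_apply, neg_apply, functional_apply,
    Fin.sum_univ_four, chordGrad, smul_eq_mul]
  change 1 / (2 * chord z) * _ = _
  field_simp
  ring

theorem hasFDerivAt_chordGrad {z : Fin 4 → ℝ} (hz : cosAngle z < 1) (s : Fin 4) :
    HasFDerivAt (fun y => chordGrad y s) (functional (chordHess z s)) z := by
  have hp := chord_pos hz
  have h1 := (hasDerivAt_inv hp.ne').comp_hasFDerivAt z (hasFDerivAt_chord hz)
  refine ((hasFDerivAt_cosAngleGrad z s).mul h1).neg.congr_fderiv ?_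
  ext v
  simp only [Function.comp_apply, smul_apply, add_apply,
    neg_apply, functional_apply, Fin.sum_univ_four, chordGrad, chordHess,
    smul_eq_mul]
  field_simp
  ring

theorem contDiffAt_chord {z : Fin 4 → ℝ} (hz : cosAngle z < 1) : ContDiffAt ℝ 2 chord z := by
  have h : ContDiff ℝ 2 fun z => 2 - 2 * cosAngle z := by
    unfold cosAngle
    fun_prop
  exact h.contDiffAt.sqrt (by linarith)

/-- The variables that hold the latitude and the longitude of a point; `none` for a coordinate
that is held fixed. -/
def coordIndex : Fin 5 → Option (Fin 7) × Option (Fin 7) :=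
  ![(none, none), (some 0, none), (some 1, some 2), (some 3, some 4), (some 5, some 6)]

/-- The variables that hold the four coordinates of a pair of points. -/
def pairIndex (p q : Fin 5) : Fin 4 → Option (Fin 7) :=
  ![(coordIndex p).1, (coordIndex p).2, (coordIndex q).1, (coordIndex q).2]

/-- The longitudes that are held fixed, with `0` in place of the others. -/
def fixedLon : Fin 5 → ℝ := ![0, Real.pi, 0, 0, 0]

/-- The linear part of `pairCoord`. -/
def pairLinear (p q : Fin 5) : (Fin 7 → ℝ) →L[ℝ] (Fin 4 → ℝ) :=
  ContinuousLinearMap.pi fun s =>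
    (pairIndex p q s).elim 0 fun k => ContinuousLinearMap.proj (R := ℝ) k

/-- The latitudes and longitudes of the points `p` and `q`, as a function of the variables. -/
def pairCoord (p q : Fin 5) (x : Fin 7 → ℝ) : Fin 4 → ℝ :=
  ![0, fixedLon p, 0, fixedLon q] + pairLinear p q x

theorem pairLinear_single (p q : Fin 5) (s : Fin 4) (j : Fin 7) :
    pairLinear p q (Pi.single j 1) s = if pairIndex p q s = some j then 1 else 0 := by
  simp only [pairLinear, ContinuousLinearMap.pi_apply]
  cases h : pairIndex p q s with
  | none => simp
  | some k => simp [Pi.single_apply]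

theorem hasFDerivAt_pairCoord (p q : Fin 5) (x : Fin 7 → ℝ) :
    HasFDerivAt (pairCoord p q) (pairLinear p q) x :=
  (pairLinear p q).hasFDerivAt.const_add _

theorem dist_sph (a b c d : ℝ) : dist (sph a b) (sph c d) = chord ![a, b, c, d] := by
  rw [EuclideanSpace.dist_eq, chord]
  congr 1
  simp only [sph, cosAngle, Fin.sum_univ_three, Real.dist_eq, sq_abs]
  simp only [Matrix.cons_val]
  rw [Real.cos_sub]
  have h1 := Real.sin_sq_add_cos_sq a
  have h2 := Real.sin_sq_add_cos_sq b
  have h3 := Real.sin_sq_add_cos_sq c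
  have h4 := Real.sin_sq_add_cos_sq d
  linear_combination (Real.cos a) ^ 2 * h2 + (Real.cos c) ^ 2 * h4 + h1 + h3

/-- The latitudes of the five points. -/
def latitude (x : Fin 7 → ℝ) : Fin 5 → ℝ := ![0, x 0, x 1, x 3, x 5]

/-- The longitudes of the five points. -/
def longitude (x : Fin 7 → ℝ) : Fin 5 → ℝ := ![0, Real.pi, x 2, x 4, x 6]

theorem points_eq_sph (x : Fin 7 → ℝ) (p : Fin 5) :
    points x p = sph (latitude x p) (longitude x p) := by
  fin_cases p <;> rfl

theorem pairCoord_eq (p q : Fin 5) (x : Fin 7 → ℝ) :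
    pairCoord p q x = ![latitude x p, longitude x p, latitude x q, longitude x q] := by
  have hlat : ∀ p, latitude x p = (coordIndex p).1.elim 0 x := by
    intro p; fin_cases p <;> rfl
  have hlon : ∀ p, longitude x p = fixedLon p + (coordIndex p).2.elim 0 x := by
    intro p; fin_cases p <;> simp [longitude, fixedLon, coordIndex]
  rw [hlat, hlon, hlat, hlon]
  funext s
  fin_cases s <;>
    simp only [pairCoord, pairLinear, pairIndex, Pi.add_apply, ContinuousLinearMap.pi_apply,
      Fin.zero_eta, Fin.mk_one, Fin.reduceFinMk, Matrix.cons_val]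
  · cases (coordIndex p).1 <;> simp
  · cases (coordIndex p).2 <;> simp
  · cases (coordIndex q).1 <;> simp
  · cases (coordIndex q).2 <;> simp

theorem dist_points (x : Fin 7 → ℝ) (p q : Fin 5) :
    dist (points x p) (points x q) = chord (pairCoord p q x) := by
  rw [points_eq_sph, points_eq_sph, dist_sph, pairCoord_eq]

theorem f_eq_sum_chord : f = fun x => ∑ p, ∑ q ∈ Finset.Ioi p, chord (pairCoord p q x) := by
  funext x
  simp only [f, dist_points]

/-- The configurations in which no two of the five points coincide. -/
def distinctSet : Set (Fin 7 → ℝ) := {x | ∀ p q, p < q → cosAngle (pairCoord p q x) < 1}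

theorem continuous_pairCoord (p q : Fin 5) : Continuous (pairCoord p q) :=
  continuous_const.add (pairLinear p q).continuous

theorem isOpen_distinctSet : IsOpen distinctSet := by
  have hc : Continuous cosAngle := by unfold cosAngle; fun_prop
  simp only [distinctSet, Set.ofPred_forall]
  refine isOpen_iInter_of_finite fun p => isOpen_iInter_of_finite fun q =>
    isOpen_iInter_of_finite fun _ => ?_
  exact isOpen_lt (hc.comp (continuous_pairCoord p q)) continuous_const

theorem contDiffAt_f {x : Fin 7 → ℝ} (hx : x ∈ distinctSet) : ContDiffAt ℝ 2 f x := by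
  rw [f_eq_sum_chord]
  refine ContDiffAt.sum fun p _ => ContDiffAt.sum fun q hq => ?_
  refine (contDiffAt_chord (hx p q (Finset.mem_Ioi.1 hq))).comp x ?_
  exact contDiffAt_const.add (pairLinear p q).contDiff.contDiffAt

theorem hasFDerivAt_f {x : Fin 7 → ℝ} (hx : x ∈ distinctSet) :
    HasFDerivAt f (∑ p, ∑ q ∈ Finset.Ioi p,
      (functional (chordGrad (pairCoord p q x))).comp (pairLinear p q)) x := by
  rw [f_eq_sum_chord]
  refine HasFDerivAt.fun_sum fun p _ => HasFDerivAt.fun_sum fun q hq => ?_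
  exact (hasFDerivAt_chord (hx p q (Finset.mem_Ioi.1 hq))).comp x (hasFDerivAt_pairCoord p q x)

theorem fderiv_f_apply {x : Fin 7 → ℝ} (hx : x ∈ distinctSet) (v : Fin 7 → ℝ) :
    fderiv ℝ f x v = ∑ p, ∑ q ∈ Finset.Ioi p, ∑ s,
      chordGrad (pairCoord p q x) s * pairLinear p q v s := by
  rw [(hasFDerivAt_f hx).fderiv]
  simp [functional_apply]

theorem hessian_f_apply {x : Fin 7 → ℝ} (hx : x ∈ distinctSet) (i j : Fin 7) :
    hessian f x i j = ∑ p, ∑ q ∈ Finset.Ioi p, ∑ s, ∑ t,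
      if pairIndex p q s = some i ∧ pairIndex p q t = some j then
        chordHess (pairCoord p q x) t s else 0 := by
  have hev : (fun y => fderiv ℝ f y (Pi.single j 1)) =ᶠ[nhds x]
      fun y => ∑ p, ∑ q ∈ Finset.Ioi p, ∑ t,
        chordGrad (pairCoord p q y) t * pairLinear p q (Pi.single j 1) t := by
    filter_upwards [isOpen_distinctSet.mem_nhds hx] with y hy using fderiv_f_apply hy _
  have hd : HasFDerivAt (fun y => ∑ p, ∑ q ∈ Finset.Ioi p, ∑ t,
        chordGrad (pairCoord p q y) t * pairLinear p q (Pi.single j 1) t)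
      (∑ p, ∑ q ∈ Finset.Ioi p, ∑ t, pairLinear p q (Pi.single j 1) t •
        (functional (chordHess (pairCoord p q x) t)).comp (pairLinear p q)) x := by
    refine HasFDerivAt.fun_sum fun p _ => HasFDerivAt.fun_sum fun q hq =>
      HasFDerivAt.fun_sum fun t _ => HasFDerivAt.mul_const ?_ _
    exact (hasFDerivAt_chordGrad (hx p q (Finset.mem_Ioi.1 hq)) t).comp x
      (hasFDerivAt_pairCoord p q x)
  rw [hessian, Matrix.of_apply, hev.fderiv_eq, hd.fderiv]
  simp only [sum_apply, smul_apply,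
    ContinuousLinearMap.comp_apply, functional_apply, pairLinear_single, smul_eq_mul,
    Finset.mul_sum]
  refine Finset.sum_congr rfl fun p _ => Finset.sum_congr rfl fun q _ => ?_
  rw [Finset.sum_comm]
  refine Finset.sum_congr rfl fun s _ => Finset.sum_congr rfl fun t _ => ?_
  by_cases h1 : pairIndex p q s = some i <;> by_cases h2 : pairIndex p q t = some j <;>
    simp [h1, h2]

end

/-! ### Rational interval arithmetic -/

/-- A closed interval with rational endpoints. -/
structure Ival where
  /-- The lower endpoint. -/
  lo : ℚ
  /-- The upper endpoint. -/
  hi : ℚ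

namespace Ival

/-- The real number `x` lies in the interval `I`. -/
def Mem (I : Ival) (x : ℝ) : Prop := (I.lo : ℝ) ≤ x ∧ x ≤ I.hi

/-- The interval whose endpoints are the given multiples of `10⁻⁸`. -/
def fixed (l h : ℤ) : Ival := ⟨l / 10 ^ 8, h / 10 ^ 8⟩

/-- The degenerate interval at a rational number. -/
def pure (q : ℚ) : Ival := ⟨q, q⟩

instance : Zero Ival := ⟨pure 0⟩

instance : Add Ival := ⟨fun I J => ⟨I.lo + J.lo, I.hi + J.hi⟩⟩

instance : AddCommMonoid Ival where
  add_assoc I J K := congrArg₂ mk (add_assoc _ _ _) (add_assoc _ _ _)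
  zero_add I := congrArg₂ mk (zero_add _) (zero_add _)
  add_zero I := congrArg₂ mk (add_zero _) (add_zero _)
  add_comm I J := congrArg₂ mk (add_comm _ _) (add_comm _ _)
  nsmul := nsmulRec

instance : Neg Ival := ⟨fun I => ⟨-I.hi, -I.lo⟩⟩

instance : Sub Ival := ⟨fun I J => ⟨I.lo - J.hi, I.hi - J.lo⟩⟩

instance : Mul Ival := ⟨fun I J =>
  ⟨min (min (I.lo * J.lo) (I.lo * J.hi)) (min (I.hi * J.lo) (I.hi * J.hi)),
    max (max (I.lo * J.lo) (I.lo * J.hi)) (max (I.hi * J.lo) (I.hi * J.hi))⟩⟩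

/-- The set of squares; sharper than `I * I` when `I` contains `0`. -/
def sq (I : Ival) : Ival :=
  ⟨if I.lo ≤ 0 ∧ 0 ≤ I.hi then 0 else min (I.lo ^ 2) (I.hi ^ 2), max (I.lo ^ 2) (I.hi ^ 2)⟩

/-- The intersection. -/
def inter (I J : Ival) : Ival := ⟨max I.lo J.lo, min I.hi J.hi⟩

/-- The set of inverses of an interval of positive numbers. -/
def inv (I : Ival) : Ival := ⟨1 / I.hi, 1 / I.lo⟩

variable {I J : Ival} {x y : ℝ}

theorem mem_fixed {l h : ℤ} : (fixed l h).Mem x ↔ (l : ℝ) / 10 ^ 8 ≤ x ∧ x ≤ h / 10 ^ 8 := by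
  simp [fixed, Mem]

theorem mem_pure {q : ℚ} (h : (q : ℝ) = x) : (pure q).Mem x := ⟨h.le, h.ge⟩

theorem Mem.of_eq (h : I.Mem y) (e : x = y) : I.Mem x := e ▸ h

theorem mem_zero : (0 : Ival).Mem 0 := mem_pure Rat.cast_zero

theorem Mem.add (hx : I.Mem x) (hy : J.Mem y) : (I + J).Mem (x + y) := by
  constructor
  · change ((I.lo + J.lo : ℚ) : ℝ) ≤ _
    push_cast
    exact add_le_add hx.1 hy.1
  · change _ ≤ ((I.hi + J.hi : ℚ) : ℝ)
    push_cast
    exact add_le_add hx.2 hy.2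

theorem Mem.neg (hx : I.Mem x) : (-I).Mem (-x) := by
  constructor
  · change ((-I.hi : ℚ) : ℝ) ≤ _
    push_cast
    exact neg_le_neg hx.2
  · change _ ≤ ((-I.lo : ℚ) : ℝ)
    push_cast
    exact neg_le_neg hx.1

theorem Mem.sub (hx : I.Mem x) (hy : J.Mem y) : (I - J).Mem (x - y) := by
  constructor
  · change ((I.lo - J.hi : ℚ) : ℝ) ≤ _
    push_cast
    exact sub_le_sub hx.1 hy.2
  · change _ ≤ ((I.hi - J.lo : ℚ) : ℝ)
    push_cast
    exact sub_le_sub hx.2 hy.1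

theorem Mem.mul (hx : I.Mem x) (hy : J.Mem y) : (I * J).Mem (x * y) := by
  obtain ⟨h1, h2⟩ := hx
  obtain ⟨h3, h4⟩ := hy
  constructor
  · change ((min (min (I.lo * J.lo) (I.lo * J.hi)) (min (I.hi * J.lo) (I.hi * J.hi)) : ℚ) : ℝ) ≤ _
    push_cast
    rcases le_total 0 x with hx | hx
    · have h5 : x * J.lo ≤ x * y := mul_le_mul_of_nonneg_left h3 hx
      rcases le_total 0 (J.lo : ℝ) with h | h
      · exact le_trans (min_le_of_left_le (min_le_left _ _))
          ((mul_le_mul_of_nonneg_right h1 h).trans h5)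
      · exact le_trans (min_le_of_right_le (min_le_left _ _))
          ((mul_le_mul_of_nonpos_right h2 h).trans h5)
    · have h5 : x * J.hi ≤ x * y := mul_le_mul_of_nonpos_left h4 hx
      rcases le_total 0 (J.hi : ℝ) with h | h
      · exact le_trans (min_le_of_left_le (min_le_right _ _))
          ((mul_le_mul_of_nonneg_right h1 h).trans h5)
      · exact le_trans (min_le_of_right_le (min_le_right _ _))
          ((mul_le_mul_of_nonpos_right h2 h).trans h5)
  · change _ ≤ ((max (max (I.lo * J.lo) (I.lo * J.hi)) (max (I.hi * J.lo) (I.hi * J.hi)) : ℚ) : ℝ)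
    push_cast
    rcases le_total 0 x with hx | hx
    · have h5 : x * y ≤ x * J.hi := mul_le_mul_of_nonneg_left h4 hx
      rcases le_total 0 (J.hi : ℝ) with h | h
      · exact (h5.trans (mul_le_mul_of_nonneg_right h2 h)).trans
          (le_max_of_le_right (le_max_right _ _))
      · exact (h5.trans (mul_le_mul_of_nonpos_right h1 h)).trans
          (le_max_of_le_left (le_max_right _ _))
    · have h5 : x * y ≤ x * J.lo := mul_le_mul_of_nonpos_left h3 hx
      rcases le_total 0 (J.lo : ℝ) with h | h
      · exact (h5.trans (mul_le_mul_of_nonneg_right h2 h)).trans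
          (le_max_of_le_right (le_max_left _ _))
      · exact (h5.trans (mul_le_mul_of_nonpos_right h1 h)).trans
          (le_max_of_le_left (le_max_left _ _))

theorem Mem.sq (hx : I.Mem x) : I.sq.Mem (x ^ 2) := by
  obtain ⟨h1, h2⟩ := hx
  constructor
  · change ((if I.lo ≤ 0 ∧ 0 ≤ I.hi then 0 else min (I.lo ^ 2) (I.hi ^ 2) : ℚ) : ℝ) ≤ _
    split_ifs with h
    · simpa using sq_nonneg x
    · push_cast
      by_cases h0 : I.lo ≤ 0
      · have h3 : (I.hi : ℝ) < 0 := by exact_mod_cast not_le.1 fun h' => h ⟨h0, h'⟩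
        exact min_le_of_right_le (by nlinarith)
      · have h3 : (0 : ℝ) < I.lo := by exact_mod_cast not_le.1 h0
        exact min_le_of_left_le (by nlinarith)
  · change _ ≤ ((max (I.lo ^ 2) (I.hi ^ 2) : ℚ) : ℝ)
    push_cast
    rcases le_total 0 x with h | h
    · exact le_max_of_le_right (by nlinarith)
    · exact le_max_of_le_left (by nlinarith)

theorem Mem.inter (hx : I.Mem x) (hy : J.Mem x) : (I.inter J).Mem x := by
  constructor
  · change ((max I.lo J.lo : ℚ) : ℝ) ≤ _
    push_cast
    exact max_le hx.1 hy.1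
  · change _ ≤ ((min I.hi J.hi : ℚ) : ℝ)
    push_cast
    exact le_min hx.2 hy.2

theorem Mem.inv (hx : I.Mem x) (h : 0 < I.lo) : I.inv.Mem x⁻¹ := by
  have h' : (0 : ℝ) < I.lo := by exact_mod_cast h
  have hx0 : 0 < x := h'.trans_le hx.1
  constructor
  · change ((1 / I.hi : ℚ) : ℝ) ≤ _
    push_cast
    rw [one_div]
    exact inv_anti₀ hx0 hx.2
  · change _ ≤ ((1 / I.lo : ℚ) : ℝ)
    push_cast
    rw [one_div]
    exact inv_anti₀ h' hx.1

theorem mem_sum {ι : Type*} (S : Finset ι) {F : ι → Ival} {g : ι → ℝ}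
    (h : ∀ k ∈ S, (F k).Mem (g k)) : (∑ k ∈ S, F k).Mem (∑ k ∈ S, g k) := by
  classical
  induction S using Finset.induction_on with
  | empty => exact mem_zero
  | insert a S ha ih =>
    rw [Finset.sum_insert ha, Finset.sum_insert ha]
    exact (h a (Finset.mem_insert_self a S)).add
      (ih fun k hk => h k (Finset.mem_insert_of_mem hk))

end Ival

/-- Intervals for the trigonometric data of a pair of points: the cosine, the sine and their
product for the two latitudes `a` and `c`, the cosine and the sine of the difference `δ` of the
longitudes, the cosine `u` of the angle at the centre, and the distance `d`. The products
`cos * sin` have intervals of their own because these are much sharper than the product of the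
intervals of the factors. -/
structure ChordBox where
  /-- Encloses `cos a`. -/
  ca : Ival
  /-- Encloses `sin a`. -/
  sa : Ival
  /-- Encloses `cos a * sin a`. -/
  pa : Ival
  /-- Encloses `cos c`. -/
  cc : Ival
  /-- Encloses `sin c`. -/
  sc : Ival
  /-- Encloses `cos c * sin c`. -/
  pc : Ival
  /-- Encloses `cos δ`. -/
  cd : Ival
  /-- Encloses `sin δ`. -/
  sd : Ival
  /-- Encloses the cosine of the angle at the centre. -/
  u : Ival
  /-- Encloses the distance. -/
  d : Ival

namespace ChordBox

/-- The coordinates `z` of a pair of points lie in the box. -/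
structure Holds (B : ChordBox) (z : Fin 4 → ℝ) : Prop where
  ca : B.ca.Mem (Real.cos (z 0))
  sa : B.sa.Mem (Real.sin (z 0))
  pa : B.pa.Mem (Real.cos (z 0) * Real.sin (z 0))
  cc : B.cc.Mem (Real.cos (z 2))
  sc : B.sc.Mem (Real.sin (z 2))
  pc : B.pc.Mem (Real.cos (z 2) * Real.sin (z 2))
  cd : B.cd.Mem (Real.cos (z 1 - z 3))
  sd : B.sd.Mem (Real.sin (z 1 - z 3))
  u : B.u.Mem (cosAngle z)
  d : B.d.Mem (chord z)
  d_pos : 0 < B.d.lo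

/-- The box with the two latitudes exchanged; the data of the longitudes are kept. -/
def swap (B : ChordBox) : ChordBox :=
  { B with ca := B.cc, sa := B.sc, pa := B.pc, cc := B.ca, sc := B.sa, pc := B.pa }

/-- Encloses the inverse of the distance. -/
def w (B : ChordBox) : Ival := B.d.inv

/-- Encloses the inverse cube of the distance. -/
def w3 (B : ChordBox) : Ival := B.w * B.w.sq

/-- Encloses a quarter of the distance. -/
def d4 (B : ChordBox) : Ival := Ival.pure (1 / 4) * B.d

/-- Encloses the second derivative in the first latitude. -/
def latLat (B : ChordBox) : Ival := -B.d4 + (B.cc * B.sd).sq * B.w3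

/-- Encloses the second derivative in the first longitude. -/
def lonLon (B : ChordBox) : Ival :=
  (-B.d4 + (B.sa - B.sc).sq * B.w3).inter
    (B.ca * B.cc * B.cd * (B.w - (B.ca * B.cc).sq * B.w3)
      - (B.ca * B.cc).sq * (Ival.pure (1 / 2) * B.w + B.sa * B.sc * B.w3)
      + (B.ca * B.cc * B.cd).sq * B.w3)

/-- Encloses the mixed derivative in the two latitudes. -/
def latLatMixed (B : ChordBox) : Ival :=
  (-(B.w * (B.sa * B.sc * B.cd + B.ca * B.cc
    + (B.pa * B.pc * (Ival.pure 1 + B.cd.sq)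
      - B.cd * ((B.ca * B.sc).sq + (B.sa * B.cc).sq)) * B.w.sq))).inter
  (-B.d4 - B.w3 * (Ival.pure 1 + B.cd)
    * ((Ival.pure 2 - B.u) * (B.ca * B.cc + B.sa * B.sc) - Ival.pure 1))

/-- Encloses the mixed derivative in the first latitude and the first longitude. -/
def latLon (B : ChordBox) : Ival :=
  (B.sd * (-(B.sa * B.cc * B.w) + (B.ca.sq * B.pc - B.pa * B.cc.sq * B.cd) * B.w3)).inter
    (B.sd * B.cc * B.w3 * (B.sc - B.sa * (Ival.pure 2 - B.u)))

/-- Encloses the second derivatives of `chord`. -/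
def hess (B : ChordBox) : Fin 4 → Fin 4 → Ival :=
  ![![B.latLat, B.latLon, B.latLatMixed, -B.latLon],
    ![B.latLon, B.lonLon, B.swap.latLon, -B.lonLon],
    ![B.latLatMixed, B.swap.latLon, B.swap.latLat, -B.swap.latLon],
    ![-B.latLon, -B.lonLon, -B.swap.latLon, B.lonLon]]

end ChordBox

/-! ### Sharp forms of the second derivatives of the distance -/

section SecondDerivatives

open Real

variable {z : Fin 4 → ℝ}

theorem chord_sq (hz : cosAngle z < 1) : chord z ^ 2 = 2 - 2 * cosAngle z :=
  Real.sq_sqrt (by linarith)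

/-- The inverse distance and the distance, written with the inverse cube of the distance. -/
theorem chord_eq_inv_cube (hz : cosAngle z < 1) :
    (chord z)⁻¹ = (chord z)⁻¹ ^ 3 * (2 - 2 * cosAngle z) ∧
      chord z = (chord z)⁻¹ ^ 3 * (2 - 2 * cosAngle z) ^ 2 := by
  have h := (chord_pos hz).ne'
  rw [← chord_sq hz]
  constructor <;> field_simp

theorem chordHess_comm (z : Fin 4 → ℝ) (s t : Fin 4) : chordHess z s t = chordHess z t s := by
  have h : cosAngleHess z s t = cosAngleHess z t s := by
    fin_cases s <;> fin_cases t <;> rfl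
  rw [chordHess, chordHess, h]
  ring

theorem chordHess_zero_zero (hz : cosAngle z < 1) :
    chordHess z 0 0 = -(1 / 4 * chord z) + (cos (z 2) * sin (z 1 - z 3)) ^ 2 * ((chord z)⁻¹
      * (chord z)⁻¹ ^ 2) := by
  obtain ⟨h1, h2⟩ := chord_eq_inv_cube hz
  have ha := sin_sq_add_cos_sq (z 0)
  have hc := sin_sq_add_cos_sq (z 2)
  have hd := sin_sq_add_cos_sq (z 1 - z 3)
  simp only [chordHess, cosAngleHess, cosAngleGrad, Matrix.cons_val]
  simp only [cosAngle] at h1 h2 ⊢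
  linear_combination (cos (z 0) * cos (z 2) * cos (z 1 - z 3) + sin (z 0) * sin (z 2)) * h1 + 1 / 4
    * h2 - (chord z)⁻¹ ^ 3 * ((cos (z 2) ^ 2 * cos (z 1 - z 3) ^ 2 + sin (z 2) ^ 2) * ha
    + cos (z 2) ^ 2 * hd + hc)

theorem chordHess_two_two (hz : cosAngle z < 1) :
    chordHess z 2 2 = -(1 / 4 * chord z) + (cos (z 0) * sin (z 1 - z 3)) ^ 2 * ((chord z)⁻¹
      * (chord z)⁻¹ ^ 2) := by
  obtain ⟨h1, h2⟩ := chord_eq_inv_cube hz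
  have ha := sin_sq_add_cos_sq (z 0)
  have hc := sin_sq_add_cos_sq (z 2)
  have hd := sin_sq_add_cos_sq (z 1 - z 3)
  simp only [chordHess, cosAngleHess, cosAngleGrad, Matrix.cons_val]
  simp only [cosAngle] at h1 h2 ⊢
  linear_combination (cos (z 0) * cos (z 2) * cos (z 1 - z 3) + sin (z 0) * sin (z 2)) * h1 + 1 / 4
    * h2 - (chord z)⁻¹ ^ 3 * ((cos (z 0) ^ 2 * cos (z 1 - z 3) ^ 2 + sin (z 0) ^ 2) * hc
    + cos (z 0) ^ 2 * hd + ha)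

/-- Up to a term that vanishes for equal latitudes, moving a longitude changes a distance like the
chord of a circle. -/
theorem chordHess_one_one (hz : cosAngle z < 1) :
    chordHess z 1 1 = -(1 / 4 * chord z) + (sin (z 0) - sin (z 2)) ^ 2 * ((chord z)⁻¹
      * (chord z)⁻¹ ^ 2) := by
  obtain ⟨h1, h2⟩ := chord_eq_inv_cube hz
  have ha := sin_sq_add_cos_sq (z 0)
  have hc := sin_sq_add_cos_sq (z 2)
  have hd := sin_sq_add_cos_sq (z 1 - z 3)
  simp only [chordHess, cosAngleHess, cosAngleGrad, Matrix.cons_val]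
  simp only [cosAngle] at h1 h2 ⊢
  linear_combination cos (z 0) * cos (z 2) * cos (z 1 - z 3) * h1 + 1 / 4 * h2 - (chord z)⁻¹ ^ 3
    * ((cos (z 0) * cos (z 2)) ^ 2 * hd + cos (z 2) ^ 2 * ha + (1 - sin (z 0) ^ 2) * hc)

/-- A form suited to nearly orthogonal points: the cube of the inverse distance is expanded once
around the distance `√2`. -/
theorem chordHess_one_one_expanded (hz : cosAngle z < 1) :
    chordHess z 1 1 = cos (z 0) * cos (z 2) * cos (z 1 - z 3) * ((chord z)⁻¹ - (cos (z 0)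
      * cos (z 2)) ^ 2 * ((chord z)⁻¹ * (chord z)⁻¹ ^ 2)) - (cos (z 0) * cos (z 2)) ^ 2 * (1 / 2
      * (chord z)⁻¹ + sin (z 0) * sin (z 2) * ((chord z)⁻¹ * (chord z)⁻¹ ^ 2)) + (cos (z 0)
      * cos (z 2) * cos (z 1 - z 3)) ^ 2 * ((chord z)⁻¹ * (chord z)⁻¹ ^ 2) := by
  obtain ⟨h1, -⟩ := chord_eq_inv_cube hz
  have hd := sin_sq_add_cos_sq (z 1 - z 3)
  simp only [chordHess, cosAngleHess, cosAngleGrad, Matrix.cons_val]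
  simp only [cosAngle] at h1 ⊢
  linear_combination (cos (z 0) * cos (z 2)) ^ 2 / 2 * h1 - (chord z)⁻¹ ^ 3 * (cos (z 0)
    * cos (z 2)) ^ 2 * hd

theorem chordHess_zero_two (z : Fin 4 → ℝ) :
    chordHess z 0 2 = -((chord z)⁻¹ * (sin (z 0) * sin (z 2) * cos (z 1 - z 3) + cos (z 0)
      * cos (z 2) + (cos (z 0) * sin (z 0) * (cos (z 2) * sin (z 2)) * (1 + cos (z 1 - z 3) ^ 2)
      - cos (z 1 - z 3) * ((cos (z 0) * sin (z 2)) ^ 2 + (sin (z 0) * cos (z 2)) ^ 2))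
      * (chord z)⁻¹ ^ 2)) := by
  simp only [chordHess, cosAngleHess, cosAngleGrad, Matrix.cons_val]
  ring

/-- A form suited to nearly antipodal points, where `1 + cos (z 1 - z 3)` is small. -/
theorem chordHess_zero_two_antipodal (hz : cosAngle z < 1) :
    chordHess z 0 2 = -(1 / 4 * chord z) - (chord z)⁻¹ * (chord z)⁻¹ ^ 2 * (1 + cos (z 1 - z 3))
      * ((2 - cosAngle z) * (cos (z 0) * cos (z 2) + sin (z 0) * sin (z 2)) - 1) := by
  obtain ⟨h1, h2⟩ := chord_eq_inv_cube hz
  have ha := sin_sq_add_cos_sq (z 0)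
  have hc := sin_sq_add_cos_sq (z 2)
  simp only [chordHess, cosAngleHess, cosAngleGrad, Matrix.cons_val]
  simp only [cosAngle] at h1 h2 ⊢
  linear_combination -(sin (z 0) * sin (z 2) * cos (z 1 - z 3) + cos (z 0) * cos (z 2)) * h1
    + 1 / 4 * h2 + (chord z)⁻¹ ^ 3 * cos (z 1 - z 3) * ((cos (z 2) ^ 2 + sin (z 2) ^ 2) * ha + hc)

theorem chordHess_zero_one (z : Fin 4 → ℝ) :
    chordHess z 0 1 = sin (z 1 - z 3) * (-(sin (z 0) * cos (z 2) * (chord z)⁻¹) + (cos (z 0) ^ 2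
      * (cos (z 2) * sin (z 2)) - cos (z 0) * sin (z 0) * cos (z 2) ^ 2 * cos (z 1 - z 3))
      * ((chord z)⁻¹ * (chord z)⁻¹ ^ 2)) := by
  simp only [chordHess, cosAngleHess, cosAngleGrad, Matrix.cons_val]
  ring

/-- A form suited to nearly antipodal points, where both sines of latitudes are small. -/
theorem chordHess_zero_one_antipodal (hz : cosAngle z < 1) :
    chordHess z 0 1 = sin (z 1 - z 3) * cos (z 2) * ((chord z)⁻¹ * (chord z)⁻¹ ^ 2) * (sin (z 2)
      - sin (z 0) * (2 - cosAngle z)) := by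
  obtain ⟨h1, -⟩ := chord_eq_inv_cube hz
  have ha := sin_sq_add_cos_sq (z 0)
  simp only [chordHess, cosAngleHess, cosAngleGrad, Matrix.cons_val]
  simp only [cosAngle] at h1 ⊢
  linear_combination -sin (z 0) * cos (z 2) * sin (z 1 - z 3) * h1 + (chord z)⁻¹ ^ 3
    * sin (z 1 - z 3) * cos (z 2) * sin (z 2) * ha

theorem chordHess_two_one (z : Fin 4 → ℝ) :
    chordHess z 2 1 = sin (z 1 - z 3) * (-(sin (z 2) * cos (z 0) * (chord z)⁻¹) + (cos (z 2) ^ 2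
      * (cos (z 0) * sin (z 0)) - cos (z 2) * sin (z 2) * cos (z 0) ^ 2 * cos (z 1 - z 3))
      * ((chord z)⁻¹ * (chord z)⁻¹ ^ 2)) := by
  simp only [chordHess, cosAngleHess, cosAngleGrad, Matrix.cons_val]
  ring

theorem chordHess_two_one_antipodal (hz : cosAngle z < 1) :
    chordHess z 2 1 = sin (z 1 - z 3) * cos (z 0) * ((chord z)⁻¹ * (chord z)⁻¹ ^ 2) * (sin (z 0)
      - sin (z 2) * (2 - cosAngle z)) := by
  obtain ⟨h1, -⟩ := chord_eq_inv_cube hz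
  have hc := sin_sq_add_cos_sq (z 2)
  simp only [chordHess, cosAngleHess, cosAngleGrad, Matrix.cons_val]
  simp only [cosAngle] at h1 ⊢
  linear_combination -cos (z 0) * sin (z 2) * sin (z 1 - z 3) * h1 + (chord z)⁻¹ ^ 3
    * sin (z 1 - z 3) * cos (z 0) * sin (z 0) * hc

end SecondDerivatives

namespace ChordBox

variable {B : ChordBox} {z : Fin 4 → ℝ}

theorem Holds.lt_one (h : B.Holds z) : cosAngle z < 1 := by
  have h1 : 0 < chord z := lt_of_lt_of_le (by exact_mod_cast h.d_pos) h.d.1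
  have h2 := Real.sqrt_pos.1 h1
  linarith

theorem Holds.w (h : B.Holds z) : B.w.Mem (chord z)⁻¹ := h.d.inv h.d_pos

theorem Holds.w3 (h : B.Holds z) : B.w3.Mem ((chord z)⁻¹ * (chord z)⁻¹ ^ 2) := h.w.mul h.w.sq

theorem Holds.d4 (h : B.Holds z) : B.d4.Mem (1 / 4 * chord z) :=
  (Ival.mem_pure (by norm_num)).mul h.d

theorem Holds.latLat (h : B.Holds z) : B.latLat.Mem (chordHess z 0 0) := by
  rw [chordHess_zero_zero h.lt_one]
  exact h.d4.neg.add ((h.cc.mul h.sd).sq.mul h.w3)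

theorem Holds.swap_latLat (h : B.Holds z) : B.swap.latLat.Mem (chordHess z 2 2) := by
  rw [chordHess_two_two h.lt_one]
  exact h.d4.neg.add ((h.ca.mul h.sd).sq.mul h.w3)

theorem Holds.lonLon (h : B.Holds z) : B.lonLon.Mem (chordHess z 1 1) := by
  refine Ival.Mem.inter ?_ ?_
  · rw [chordHess_one_one h.lt_one]
    exact h.d4.neg.add ((h.sa.sub h.sc).sq.mul h.w3)
  · rw [chordHess_one_one_expanded h.lt_one]
    have hm := (h.ca.mul h.cc).sq
    exact ((((h.ca.mul h.cc).mul h.cd).mul (h.w.sub (hm.mul h.w3))).sub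
      (hm.mul (((Ival.mem_pure (by norm_num)).mul h.w).add ((h.sa.mul h.sc).mul h.w3)))).add
      (((h.ca.mul h.cc).mul h.cd).sq.mul h.w3)

theorem Holds.latLatMixed (h : B.Holds z) : B.latLatMixed.Mem (chordHess z 0 2) := by
  refine Ival.Mem.inter ?_ ?_
  · rw [chordHess_zero_two]
    exact (h.w.mul ((((h.sa.mul h.sc).mul h.cd).add (h.ca.mul h.cc)).add
      ((((h.pa.mul h.pc).mul ((Ival.mem_pure (by norm_num)).add h.cd.sq)).sub
        (h.cd.mul ((h.ca.mul h.sc).sq.add (h.sa.mul h.cc).sq))).mul h.w.sq))).neg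
  · rw [chordHess_zero_two_antipodal h.lt_one]
    exact h.d4.neg.sub ((h.w3.mul ((Ival.mem_pure (by norm_num)).add h.cd)).mul
      ((((Ival.mem_pure (by norm_num)).sub h.u).mul
        ((h.ca.mul h.cc).add (h.sa.mul h.sc))).sub (Ival.mem_pure (by norm_num))))

theorem Holds.latLon (h : B.Holds z) : B.latLon.Mem (chordHess z 0 1) := by
  refine Ival.Mem.inter ?_ ?_
  · rw [chordHess_zero_one]
    exact h.sd.mul (((h.sa.mul h.cc).mul h.w).neg.add
      (((h.ca.sq.mul h.pc).sub ((h.pa.mul h.cc.sq).mul h.cd)).mul h.w3))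
  · rw [chordHess_zero_one_antipodal h.lt_one]
    exact ((h.sd.mul h.cc).mul h.w3).mul
      (h.sc.sub (h.sa.mul ((Ival.mem_pure (by norm_num)).sub h.u)))

theorem Holds.swap_latLon (h : B.Holds z) : B.swap.latLon.Mem (chordHess z 2 1) := by
  refine Ival.Mem.inter ?_ ?_
  · rw [chordHess_two_one]
    exact h.sd.mul (((h.sc.mul h.ca).mul h.w).neg.add
      (((h.cc.sq.mul h.pa).sub ((h.pc.mul h.ca.sq).mul h.cd)).mul h.w3))
  · rw [chordHess_two_one_antipodal h.lt_one]
    exact ((h.sd.mul h.ca).mul h.w3).mul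
      (h.sa.sub (h.sc.mul ((Ival.mem_pure (by norm_num)).sub h.u)))

/-- Only the difference of the longitudes matters, so a derivative in the second longitude is
the negative of the one in the first. -/
theorem chordHess_three (z : Fin 4 → ℝ) :
    chordHess z 0 3 = -chordHess z 0 1 ∧ chordHess z 1 3 = -chordHess z 1 1 ∧
      chordHess z 2 3 = -chordHess z 2 1 ∧ chordHess z 3 3 = chordHess z 1 1 := by
  refine ⟨?_, ?_, ?_, ?_⟩ <;>
    · simp only [chordHess, cosAngleHess, cosAngleGrad, Matrix.cons_val]
      ring

theorem Holds.hess (h : B.Holds z) (s t : Fin 4) : (B.hess s t).Mem (chordHess z s t) := by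
  obtain ⟨e0, e1, e2, e3⟩ := chordHess_three z
  fin_cases s <;> fin_cases t
  · exact h.latLat
  · exact h.latLon
  · exact h.latLatMixed
  · exact e0 ▸ h.latLon.neg
  · exact chordHess_comm z 0 1 ▸ h.latLon
  · exact h.lonLon
  · exact chordHess_comm z 2 1 ▸ h.swap_latLon
  · exact e1 ▸ h.lonLon.neg
  · exact chordHess_comm z 0 2 ▸ h.latLatMixed
  · exact h.swap_latLon
  · exact h.swap_latLat
  · exact e2 ▸ h.swap_latLon.neg
  · exact chordHess_comm z 0 3 ▸ e0 ▸ h.latLon.neg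
  · exact chordHess_comm z 1 3 ▸ e1 ▸ h.lonLon.neg
  · exact chordHess_comm z 2 3 ▸ e2 ▸ h.swap_latLon.neg
  · exact e3 ▸ h.lonLon

end ChordBox

/-! ### Negative definiteness of the interval Hessian matrix -/

/-- `10⁶` times the lower endpoints of the interval Hessian matrix, rounded down. -/
def hessFloor : Fin 7 → Fin 7 → ℤ :=
  ![![-907308, 415813, -2504, -364356, 603801, -364356, -620954],
    ![415813, -913530, -29907, -367481, -623626, -367481, 601131],
    ![-2504, -29907, -352351, -162814, 77812, 143623, 77812],
    ![-364356, -367481, -162814, -1071925, -24200, -500070, -105],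
    ![603801, -623626, 77812, -24200, -1058714, -105, 499895],
    ![-364356, -367481, 143623, -500070, -105, -1071925, -24289],
    ![-620954, 601131, 77812, -105, 499895, -24289, -1058714]]

/-- `10⁶` times the upper endpoints of the interval Hessian matrix, rounded up. -/
def hessCeil : Fin 7 → Fin 7 → ℤ :=
  ![![-825240, 450562, 2504, -342808, 620954, -342808, -603801],
    ![450562, -819161, 29907, -339736, -601131, -339736, 623626],
    ![2504, 29907, -290186, -143623, 99162, 162814, 99162],
    ![-342808, -339736, -143623, -989169, 24289, -499930, 105],
    ![620954, -601131, 99162, 24289, -1002296, 105, 500070],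
    ![-342808, -339736, 162814, -499930, 105, -989169, 24200],
    ![-603801, 623626, 99162, 105, 500070, 24200, -1002296]]

/-- The vertex of the negated interval Hessian matrix that is extremal for the vectors with sign
pattern `z`: on such a vector its quadratic form is a lower bound for that of `-A`, for every `A`
in the interval matrix. -/
def signVertex (z : Fin 7 → Bool) (i j : Fin 7) : ℤ :=
  if z i = z j then -hessCeil i j else -hessFloor i j

/-- Positivity of all pivots in fraction-free symmetric Gaussian elimination. -/
def pivotsPos : (n : ℕ) → (Fin n → Fin n → ℤ) → Bool
  | 0, _ => true
  | n + 1, M => decide (0 < M 0 0) &&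
      pivotsPos n fun i j => M 0 0 * M i.succ j.succ - M 0 i.succ * M 0 j.succ

/-- A symmetric integer matrix with positive pivots is positive definite. -/
theorem quadForm_pos_of_pivotsPos : ∀ (n : ℕ) (M : Fin n → Fin n → ℤ),
    (∀ i j, M i j = M j i) → pivotsPos n M = true → ∀ x : Fin n → ℝ, x ≠ 0 →
    0 < ∑ i, ∑ j, (M i j : ℝ) * x i * x j := by
  intro n
  induction n with
  | zero => intro M _ _ x hx; exact absurd (Subsingleton.elim x 0) hx
  | succ n ih =>
    intro M hM hp x hx
    simp only [pivotsPos, Bool.and_eq_true, decide_eq_true_eq] at hp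
    obtain ⟨h0, hp⟩ := hp
    have h0' : (0 : ℝ) < M 0 0 := by exact_mod_cast h0
    set N : Fin n → Fin n → ℤ := fun i j => M 0 0 * M i.succ j.succ - M 0 i.succ * M 0 j.succ
    set y : Fin n → ℝ := fun i => x i.succ
    set s : ℝ := ∑ i, (M 0 i.succ : ℝ) * y i
    have hs2 : s * s = ∑ i, ∑ j, (M 0 i.succ : ℝ) * M 0 j.succ * y i * y j := by
      simp only [s, Finset.sum_mul_sum]
      exact Finset.sum_congr rfl fun i _ => Finset.sum_congr rfl fun j _ => by ring
    -- completing the square in the first variable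
    have key : (M 0 0 : ℝ) * ∑ i, ∑ j, (M i j : ℝ) * x i * x j
        = (M 0 0 * x 0 + s) ^ 2 + ∑ i, ∑ j, (N i j : ℝ) * y i * y j := by
      have e1 : ∑ i, ∑ j, (N i j : ℝ) * y i * y j
          = M 0 0 * ∑ i : Fin n, ∑ j : Fin n, (M i.succ j.succ : ℝ) * y i * y j - s * s := by
        rw [hs2, Finset.mul_sum, ← Finset.sum_sub_distrib]
        refine Finset.sum_congr rfl fun i _ => ?_
        rw [Finset.mul_sum, ← Finset.sum_sub_distrib]
        refine Finset.sum_congr rfl fun j _ => ?_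
        simp only [N]; push_cast; ring
      have e2 : ∑ i, ∑ j, (M i j : ℝ) * x i * x j = M 0 0 * x 0 * x 0 + 2 * x 0 * s
          + ∑ i : Fin n, ∑ j : Fin n, (M i.succ j.succ : ℝ) * y i * y j := by
        rw [Fin.sum_univ_succ, Fin.sum_univ_succ]
        simp only [Fin.sum_univ_succ (n := n), Finset.sum_add_distrib]
        have a1 : ∑ j : Fin n, (M 0 j.succ : ℝ) * x 0 * x j.succ = x 0 * s := by
          rw [Finset.mul_sum]; exact Finset.sum_congr rfl fun j _ => by simp only [y]; ring
        have a2 : ∑ j : Fin n, (M j.succ 0 : ℝ) * x j.succ * x 0 = x 0 * s := by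
          rw [Finset.mul_sum]
          exact Finset.sum_congr rfl fun j _ => by rw [hM j.succ 0]; simp only [y]; ring
        rw [a1, a2]; ring
      rw [e1, e2]; ring
    have hN : ∀ i j, N i j = N j i := fun i j => by simp only [N, hM i.succ j.succ]; ring
    refine pos_of_mul_pos_right (a := (M 0 0 : ℝ)) ?_ h0'.le
    rw [key]
    by_cases hy : y = 0
    · have hx0 : x 0 ≠ 0 := fun h => hx <| by
        funext i
        refine Fin.cases h (fun j => ?_) i
        exact congrFun hy j
      have hs : s = 0 := by simp [s, hy]
      have : 0 < ((M 0 0 : ℝ) * x 0) ^ 2 := by positivity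
      simpa [hs, hy] using this
    · have := ih N hN hp y hy
      positivity

set_option maxRecDepth 100000 in
theorem pivotsPos_signVertex : ∀ z : Fin 7 → Bool, pivotsPos 7 (signVertex z) = true := by
  decide +kernel

theorem hessFloor_symm : ∀ i j, hessFloor i j = hessFloor j i := by decide

theorem hessCeil_symm : ∀ i j, hessCeil i j = hessCeil j i := by decide

/-- The lower bound serves the negative definiteness of the interval matrix, the upper bound the
enclosure of the Hessian matrix. -/
theorem hessFloor_bounds (i j : Fin 7) :
    (hessFloor i j : ℝ) ≤ 10 ^ 6 * hessLower i j ∧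
      10 ^ 6 * hessLower i j ≤ hessFloor i j + 1 := by
  fin_cases i <;> fin_cases j <;> norm_num [hessFloor, hessLower]

/-- The upper bound serves the negative definiteness of the interval matrix, the lower bound the
enclosure of the Hessian matrix. -/
theorem hessCeil_bounds (i j : Fin 7) :
    (hessCeil i j - 1 : ℝ) ≤ 10 ^ 6 * hessUpper i j ∧
      10 ^ 6 * hessUpper i j ≤ hessCeil i j := by
  fin_cases i <;> fin_cases j <;> norm_num [hessCeil, hessUpper]

/-- The sign pattern of `x` selects the vertex matrix whose quadratic form bounds that of `-A` at
`x` from below. -/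
theorem isNegDef_intervalHessian : IsNegDef intervalHessian := by
  rintro A ⟨hA, hb⟩
  refine Matrix.PosDef.of_dotProduct_mulVec_pos ?_ fun x hx => ?_
  · rw [Matrix.IsHermitian, Matrix.conjTranspose_eq_transpose_of_trivial, Matrix.transpose_neg,
      hA.eq]
  · set z : Fin 7 → Bool := fun i => decide (0 ≤ x i)
    have hpos := quadForm_pos_of_pivotsPos 7 (signVertex z)
      (fun i j => by simp only [signVertex, hessFloor_symm i j, hessCeil_symm i j, eq_comm])
      (pivotsPos_signVertex z) x hx
    have hle : ∑ i, ∑ j, (signVertex z i j : ℝ) * x i * x j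
        ≤ 10 ^ 6 * ∑ i, ∑ j, -A i j * x i * x j := by
      rw [Finset.mul_sum]
      refine Finset.sum_le_sum fun i _ => ?_
      rw [Finset.mul_sum]
      refine Finset.sum_le_sum fun j _ => ?_
      obtain ⟨h1, h2⟩ := hb i j
      have h3 := (hessFloor_bounds i j).1
      have h4 := (hessCeil_bounds i j).2
      by_cases h : z i = z j
      · have hx2 : 0 ≤ x i * x j := by
          simp only [z, decide_eq_decide] at h
          by_cases hi : 0 ≤ x i
          · exact mul_nonneg hi (h.1 hi)
          · exact mul_nonneg_of_nonpos_of_nonpos (not_le.1 hi).le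
              (not_le.1 fun h' => hi (h.2 h')).le
        simp only [signVertex, h, if_true]
        push_cast
        nlinarith [mul_le_mul_of_nonneg_right (show 10 ^ 6 * A i j ≤ hessCeil i j by linarith) hx2]
      · have hx2 : x i * x j ≤ 0 := by
          simp only [z, decide_eq_decide] at h
          by_cases hi : 0 ≤ x i
          · exact mul_nonpos_of_nonneg_of_nonpos hi
              (not_le.1 fun h' => h ⟨fun _ => h', fun _ => hi⟩).le
          · have hj : 0 ≤ x j := by
              by_contra h'
              exact h ⟨fun a => absurd a hi, fun a => absurd a h'⟩
            exact mul_nonpos_of_nonpos_of_nonneg (not_le.1 hi).le hj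
        simp only [signVertex, h, if_false]
        push_cast
        nlinarith [mul_le_mul_of_nonpos_right (show hessFloor i j ≤ 10 ^ 6 * A i j by linarith) hx2]
    have he : star x ⬝ᵥ (-A).mulVec x = ∑ i, ∑ j, -A i j * x i * x j := by
      simp only [dotProduct, Matrix.mulVec, star_trivial, Matrix.neg_apply, Finset.mul_sum]
      exact Finset.sum_congr rfl fun i _ => Finset.sum_congr rfl fun j _ => by ring
    rw [he]
    linarith

/-! ### Enclosures of the trigonometric functions over the box -/

section Trigonometry

open Real

variable {ε ρ : ℝ}

theorem abs_sin_le_of_abs_le (h : |ε| ≤ ρ) : |sin ε| ≤ ρ := by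
  rcases le_total 0 ε with h0 | h0
  · exact abs_sin_le_abs.trans h
  · exact abs_sin_le_abs.trans h

theorem one_sub_sq_div_two_le_cos_of_abs_le (h : |ε| ≤ ρ) : 1 - ρ ^ 2 / 2 ≤ cos ε := by
  have h1 := one_sub_sq_div_two_le_cos (x := ε)
  have h2 : ε ^ 2 ≤ ρ ^ 2 := sq_le_sq' (abs_le.1 h).1 (abs_le.1 h).2
  linarith

theorem cos_le_one_sub_sin_sq_div_two (ε : ℝ) : cos ε ≤ 1 - sin ε ^ 2 / 2 := by
  nlinarith [sin_sq_add_cos_sq ε, sq_nonneg (1 - cos ε)]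

theorem sqrt_three_bounds : (1.7320508 : ℝ) < √3 ∧ √3 < 1.7320509 :=
  ⟨Real.lt_sqrt_of_sq_lt (by norm_num), (Real.sqrt_lt' (by norm_num)).2 (by norm_num)⟩

/-- The half width of the box about the bipyramid coordinates, slightly enlarged. -/
noncomputable abbrev radius : ℝ := 833314 / 10 ^ 8

/-- Near `π / 3` the cosine and the sine are monotone, so their ranges are given by the end
points; the bound `cos ε ≤ 1 - sin ε ^ 2 / 2` keeps the correlation between the two terms of the
addition formula that a separate estimate would lose. -/
theorem cos_sin_pi_div_three_add (h : |ε| ≤ radius) :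
    (Ival.fixed 49276592 50719937).Mem (cos (π / 3 + ε)) ∧
    (Ival.fixed 86182876 87016197).Mem (sin (π / 3 + ε)) ∧
    (Ival.fixed 42878599 43717930).Mem (cos (π / 3 + ε) * sin (π / 3 + ε)) := by
  obtain ⟨s1, s2⟩ := abs_le.1 (abs_sin_le_of_abs_le h)
  have c1 := one_sub_sq_div_two_le_cos_of_abs_le h
  have c2 := cos_le_one_sub_sin_sq_div_two ε
  obtain ⟨k1, k2⟩ := sqrt_three_bounds
  have k3 : √3 * √3 = 3 := Real.mul_self_sqrt (by norm_num)
  have hcs := sin_sq_add_cos_sq ε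
  rw [cos_add, sin_add, cos_pi_div_three, sin_pi_div_three]
  simp only [Ival.mem_fixed]
  generalize sin ε = s at *
  generalize cos ε = c at *
  generalize √3 = k at *
  simp only [radius] at *
  have e : (1 / 2 * c - k / 2 * s) * (k / 2 * c + 1 / 2 * s)
      = k / 4 * (1 - 2 * s ^ 2) - 1 / 2 * (s * c) := by
    linear_combination (-(s * c) / 4) * k3 + k / 4 * hcs
  have c0 : 0 ≤ c := by linarith
  have b1 : s * c ≤ 833314 / 10 ^ 8 := by nlinarith
  have b2 : -(833314 / 10 ^ 8) ≤ s * c := by nlinarith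
  have b3 : s ^ 2 ≤ (833314 / 10 ^ 8) ^ 2 := by nlinarith
  refine ⟨⟨?_, ?_⟩, ⟨?_, ?_⟩, ⟨?_, ?_⟩⟩
  · push_cast
    nlinarith
  · push_cast
    nlinarith [mul_nonneg (show 0 ≤ s + 833314 / 10 ^ 8 by linarith)
      (show 0 ≤ k / 2 - (833314 / 10 ^ 8 - s) / 4 by linarith)]
  · push_cast
    nlinarith
  · push_cast
    nlinarith [mul_nonneg (show 0 ≤ 833314 / 10 ^ 8 - s by linarith)
      (show 0 ≤ 1 / 2 - k / 4 * (833314 / 10 ^ 8 + s) by nlinarith)]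
  · rw [e]
    push_cast
    nlinarith
  · rw [e]
    push_cast
    nlinarith

theorem cos_sin_of_abs_le_radius (h : |ε| ≤ radius) :
    (Ival.fixed 99996527 100000000).Mem (cos ε) ∧
    (Ival.fixed (-833314) 833314).Mem (sin ε) ∧
    (Ival.fixed (-833314) 833314).Mem (cos ε * sin ε) := by
  obtain ⟨s1, s2⟩ := abs_le.1 (abs_sin_le_of_abs_le h)
  have c1 := one_sub_sq_div_two_le_cos_of_abs_le h
  have c2 := cos_le_one ε
  simp only [Ival.mem_fixed]
  simp only [radius] at *
  generalize sin ε = s at *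
  generalize cos ε = c at *
  have c0 : 0 ≤ c := by linarith
  refine ⟨⟨?_, ?_⟩, ⟨?_, ?_⟩, ⟨?_, ?_⟩⟩ <;> push_cast
  · linarith
  · linarith
  · linarith
  · linarith
  · nlinarith
  · nlinarith

theorem cos_sin_of_abs_le_two_mul_radius (h : |ε| ≤ 2 * radius) :
    (Ival.fixed 99986111 100000000).Mem (cos ε) ∧
    (Ival.fixed (-1666628) 1666628).Mem (sin ε) := by
  obtain ⟨s1, s2⟩ := abs_le.1 (abs_sin_le_of_abs_le h)
  have c1 := one_sub_sq_div_two_le_cos_of_abs_le h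
  have c2 := cos_le_one ε
  simp only [Ival.mem_fixed]
  simp only [radius] at *
  refine ⟨⟨?_, ?_⟩, ⟨?_, ?_⟩⟩ <;> push_cast <;> linarith

end Trigonometry

theorem abs_sub_thetaBp_le {x : Fin 7 → ℝ} (hx : x ∈ Dbp) (i : Fin 7) :
    |x i - thetaBp i| ≤ radius := by
  have h1 := hx.1 i
  have h2 := hx.2 i
  have p1 := Real.pi_gt_d20
  have p2 := Real.pi_lt_d20
  rw [abs_le, radius]
  fin_cases i <;> simp [boxLower, boxUpper, thetaBp] at h1 h2 ⊢ <;> constructor <;> linarith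

/-- Intervals for the cosine, the sine and their product at the latitude of a point. -/
def latBox : Fin 5 → Ival × Ival × Ival :=
  ![(Ival.pure 1, Ival.pure 0, Ival.pure 0),
    (Ival.fixed 49276592 50719937, -Ival.fixed 86182876 87016197,
      -Ival.fixed 42878599 43717930),
    (Ival.fixed 49276592 50719937, Ival.fixed 86182876 87016197, Ival.fixed 42878599 43717930),
    (Ival.fixed 99996527 100000000, Ival.fixed (-833314) 833314, Ival.fixed (-833314) 833314),
    (Ival.fixed 99996527 100000000, Ival.fixed (-833314) 833314, Ival.fixed (-833314) 833314)]

/-- Intervals for the cosine and the sine of the difference of the longitudes of two points; only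
the entries above the diagonal matter. -/
def lonBox : Fin 5 → Fin 5 → Ival × Ival :=
  let c := Ival.fixed 99996527 100000000
  let s := Ival.fixed (-833314) 833314
  let c2 := Ival.fixed 99986111 100000000
  let s2 := Ival.fixed (-1666628) 1666628
  ![![0, (Ival.pure (-1), Ival.pure 0), (-c, s), (s, c), (s, -c)],
    ![0, 0, (c, s), (s, -c), (s, c)],
    ![0, 0, 0, (s2, -c2), (s2, c2)],
    ![0, 0, 0, 0, (-c2, s2)],
    ![0, 0, 0, 0, 0]]

/-- Intervals for the distances of the points; only the entries above the diagonal matter. -/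
def distBox : Fin 5 → Fin 5 → Ival :=
  ![![0, Ival.fixed 172786916 173620240, Ival.fixed 172785925 173620240,
      Ival.fixed 140830881 142009376, Ival.fixed 140830881 142009376],
    ![0, 0, Ival.fixed 172365751 174032873, Ival.fixed 140607414 142230640,
      Ival.fixed 140607414 142230640],
    ![0, 0, 0, Ival.fixed 140306499 142527493, Ival.fixed 140306499 142527493],
    ![0, 0, 0, 0, Ival.fixed 199986110 200000000],
    ![0, 0, 0, 0, 0]]

/-- The enclosure of the coordinates of the points `p` and `q` over the box. -/
def pairBox (p q : Fin 5) : ChordBox where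
  ca := (latBox p).1
  sa := (latBox p).2.1
  pa := (latBox p).2.2
  cc := (latBox q).1
  sc := (latBox q).2.1
  pc := (latBox q).2.2
  cd := (lonBox p q).1
  sd := (lonBox p q).2
  -- the trivial bounds matter for the nearly antipodal pair, whose distance is at most `2`
  u := ((latBox p).1 * (latBox q).1 * (lonBox p q).1 + (latBox p).2.1 * (latBox q).2.1).inter
    ⟨-1, 1⟩
  d := distBox p q

/-- The intervals for the distances contain the square roots of `2 - 2u`; in particular no two of
the points coincide over the box. -/
theorem distBox_check : ∀ p q, p < q → 0 < (distBox p q).lo ∧ 0 ≤ (distBox p q).hi ∧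
    (distBox p q).lo ^ 2 ≤ 2 - 2 * (pairBox p q).u.hi ∧
    2 - 2 * (pairBox p q).u.lo ≤ (distBox p q).hi ^ 2 := by
  decide +kernel

theorem abs_cosAngle_le_one (z : Fin 4 → ℝ) : |cosAngle z| ≤ 1 := by
  have ha := Real.sin_sq_add_cos_sq (z 0)
  have hc := Real.sin_sq_add_cos_sq (z 2)
  have hd := Real.sin_sq_add_cos_sq (z 1 - z 3)
  rw [cosAngle, ← sq_le_one_iff_abs_le_one]
  generalize Real.sin (z 0) = sa at *
  generalize Real.cos (z 0) = ca at *
  generalize Real.sin (z 2) = sc at *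
  generalize Real.cos (z 2) = cc at *
  generalize Real.sin (z 1 - z 3) = sd at *
  generalize Real.cos (z 1 - z 3) = cd at *
  -- the other two components in an orthonormal basis
  have : (ca * cc * cd + sa * sc) ^ 2 + (ca * sc - sa * cc * cd) ^ 2 + (cc * sd) ^ 2 = 1 := by
    linear_combination (cc ^ 2 * cd ^ 2 + sc ^ 2) * ha + cc ^ 2 * hd + hc
  nlinarith [sq_nonneg (ca * sc - sa * cc * cd), sq_nonneg (cc * sd)]

theorem mem_latBox {x : Fin 7 → ℝ} (hx : x ∈ Dbp) (p : Fin 5) :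
    (latBox p).1.Mem (Real.cos (latitude x p)) ∧ (latBox p).2.1.Mem (Real.sin (latitude x p)) ∧
    (latBox p).2.2.Mem (Real.cos (latitude x p) * Real.sin (latitude x p)) := by
  have h := abs_sub_thetaBp_le hx
  fin_cases p
  · refine ⟨Ival.mem_pure ?_, Ival.mem_pure ?_, Ival.mem_pure ?_⟩ <;> simp [latitude]
  · obtain ⟨h1, h2, h3⟩ := cos_sin_pi_div_three_add (abs_neg (x 0 - thetaBp 0) ▸ h 0)
    have e : Real.pi / 3 + -(x 0 - thetaBp 0) = -x 0 := by
      simp [thetaBp]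
    rw [e, Real.cos_neg] at h1 h3
    rw [e, Real.sin_neg] at h2
    rw [Real.sin_neg] at h3
    refine ⟨h1, ?_, ?_⟩
    · simpa [latBox, latitude] using h2.neg
    · simpa [latBox, latitude] using h3.neg
  · obtain ⟨h1, h2, h3⟩ := cos_sin_pi_div_three_add (h 1)
    have e : Real.pi / 3 + (x 1 - thetaBp 1) = x 1 := by
      simp [thetaBp]
    rw [e] at h1 h2 h3
    exact ⟨h1, h2, h3⟩
  · exact cos_sin_of_abs_le_radius (show |x 3| ≤ radius by simpa [thetaBp] using h 3)
  · exact cos_sin_of_abs_le_radius (show |x 5| ≤ radius by simpa [thetaBp] using h 5)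

theorem mem_lonBox {x : Fin 7 → ℝ} (hx : x ∈ Dbp) {p q : Fin 5} (hpq : p < q) :
    (lonBox p q).1.Mem (Real.cos (longitude x p - longitude x q)) ∧
    (lonBox p q).2.Mem (Real.sin (longitude x p - longitude x q)) := by
  have h := abs_sub_thetaBp_le hx
  obtain ⟨ε, rfl⟩ : ∃ ε, x = thetaBp + ε := ⟨x - thetaBp, by simp⟩
  simp only [Pi.add_apply, add_sub_cancel_left] at h
  have hn : ∀ i, (Ival.fixed (-833314) 833314).Mem (Real.sin (-ε i)) := fun i =>
    (cos_sin_of_abs_le_radius ((abs_neg _).trans_le (h i))).2.1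
  have hd : ∀ i j, (Ival.fixed 99986111 100000000).Mem (Real.cos (ε i - ε j)) ∧
      (Ival.fixed (-1666628) 1666628).Mem (Real.sin (ε i - ε j)) := fun i j =>
    cos_sin_of_abs_le_two_mul_radius ((abs_sub _ _).trans (by linarith [h i, h j]))
  obtain ⟨c2, s2, -⟩ := cos_sin_of_abs_le_radius (h 2)
  obtain ⟨c4, s4, -⟩ := cos_sin_of_abs_le_radius (h 4)
  obtain ⟨c6, s6, -⟩ := cos_sin_of_abs_le_radius (h 6)
  -- the pairs `p < q` in lexicographic order
  fin_cases p <;> fin_cases q <;> first | exact absurd hpq (by decide) | skip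
  · refine ⟨Ival.mem_pure ?_, Ival.mem_pure ?_⟩ <;> simp [longitude]
  · refine ⟨c2.neg.of_eq (?_ : Real.cos (0 - (Real.pi + ε 2)) = _),
      s2.of_eq (?_ : Real.sin (0 - (Real.pi + ε 2)) = _)⟩
    all_goals simp [Real.cos_add, Real.sin_add]
  · refine ⟨s4.of_eq (?_ : Real.cos (0 - (-(Real.pi / 2) + ε 4)) = _),
      c4.of_eq (?_ : Real.sin (0 - (-(Real.pi / 2) + ε 4)) = _)⟩
    all_goals simp [Real.cos_add, Real.sin_add]
  · refine ⟨(hn 6).of_eq (?_ : Real.cos (0 - (Real.pi / 2 + ε 6)) = _),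
      c6.neg.of_eq (?_ : Real.sin (0 - (Real.pi / 2 + ε 6)) = _)⟩
    all_goals simp [Real.cos_add, Real.sin_add]
  · refine ⟨c2.of_eq (?_ : Real.cos (Real.pi - (Real.pi + ε 2)) = _),
      (hn 2).of_eq (?_ : Real.sin (Real.pi - (Real.pi + ε 2)) = _)⟩
    all_goals simp
  · refine ⟨(hn 4).of_eq (?_ : Real.cos (Real.pi - (-(Real.pi / 2) + ε 4)) = _),
      c4.neg.of_eq (?_ : Real.sin (Real.pi - (-(Real.pi / 2) + ε 4)) = _)⟩
    all_goals simp [Real.cos_add, Real.cos_sub, Real.sin_add, Real.sin_sub]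
  · refine ⟨s6.of_eq (?_ : Real.cos (Real.pi - (Real.pi / 2 + ε 6)) = _),
      c6.of_eq (?_ : Real.sin (Real.pi - (Real.pi / 2 + ε 6)) = _)⟩
    all_goals simp [Real.cos_add, Real.cos_sub, Real.sin_add, Real.sin_sub]
  · refine ⟨(hd 2 4).2.of_eq (?_ : Real.cos ((Real.pi + ε 2) - (-(Real.pi / 2) + ε 4)) = _),
      (hd 2 4).1.neg.of_eq (?_ : Real.sin ((Real.pi + ε 2) - (-(Real.pi / 2) + ε 4)) = _)⟩
    all_goals simp [Real.cos_add, Real.cos_sub, Real.sin_add, Real.sin_sub]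
    all_goals ring
  · refine ⟨(hd 6 2).2.of_eq (?_ : Real.cos ((Real.pi + ε 2) - (Real.pi / 2 + ε 6)) = _),
      (hd 6 2).1.of_eq (?_ : Real.sin ((Real.pi + ε 2) - (Real.pi / 2 + ε 6)) = _)⟩
    all_goals simp [Real.cos_add, Real.cos_sub, Real.sin_add, Real.sin_sub]
    all_goals ring
  · refine ⟨(hd 6 4).1.neg.of_eq (?_ : Real.cos ((-(Real.pi / 2) + ε 4) - (Real.pi / 2 + ε 6)) = _),
      (hd 6 4).2.of_eq (?_ : Real.sin ((-(Real.pi / 2) + ε 4) - (Real.pi / 2 + ε 6)) = _)⟩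
    all_goals simp [Real.cos_add, Real.cos_sub, Real.sin_add, Real.sin_sub]
    all_goals ring

/-! ### Enclosure of the Hessian matrix -/

theorem pairBox_holds {x : Fin 7 → ℝ} (hx : x ∈ Dbp) {p q : Fin 5} (hpq : p < q) :
    (pairBox p q).Holds (pairCoord p q x) := by
  obtain ⟨ca, sa, pa⟩ := mem_latBox hx p
  obtain ⟨cc, sc, pc⟩ := mem_latBox hx q
  obtain ⟨cd, sd⟩ := mem_lonBox hx hpq
  obtain ⟨h1, h2, h3, h4⟩ := distBox_check p q hpq
  have hu : (pairBox p q).u.Mem (cosAngle (pairCoord p q x)) := by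
    refine Ival.Mem.inter ?_ ?_
    · rw [pairCoord_eq]
      exact ((ca.mul cc).mul cd).add (sa.mul sc)
    · have h := abs_le.1 (abs_cosAngle_le_one (pairCoord p q x))
      exact ⟨by simpa using h.1, by simpa using h.2⟩
  refine ⟨?_, ?_, ?_, ?_, ?_, ?_, ?_, ?_, hu, ⟨?_, ?_⟩, h1⟩
  · rw [pairCoord_eq]; exact ca
  · rw [pairCoord_eq]; exact sa
  · rw [pairCoord_eq]; exact pa
  · rw [pairCoord_eq]; exact cc
  · rw [pairCoord_eq]; exact sc
  · rw [pairCoord_eq]; exact pc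
  · rw [pairCoord_eq]; exact cd
  · rw [pairCoord_eq]; exact sd
  · have h3' : ((distBox p q).lo : ℝ) ^ 2 ≤ 2 - 2 * (pairBox p q).u.hi := by exact_mod_cast h3
    exact Real.le_sqrt_of_sq_le (h3'.trans (by linarith [hu.2]))
  · have h4' : 2 - 2 * ((pairBox p q).u.lo : ℝ) ≤ (distBox p q).hi ^ 2 := by exact_mod_cast h4
    exact Real.sqrt_le_iff.2 ⟨by exact_mod_cast h2, le_trans (by linarith [hu.1]) h4'⟩

theorem Dbp_subset_distinctSet : Dbp ⊆ distinctSet := fun _ hx _ _ hpq =>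
  (pairBox_holds hx hpq).lt_one

/-- The enclosure of the entries of the Hessian matrix over the box. -/
def hessBox (i j : Fin 7) : Ival :=
  ∑ p, ∑ q ∈ Finset.Ioi p, ∑ s, ∑ t,
    if pairIndex p q s = some i ∧ pairIndex p q t = some j then (pairBox p q).hess t s else 0

theorem mem_hessBox {x : Fin 7 → ℝ} (hx : x ∈ Dbp) (i j : Fin 7) :
    (hessBox i j).Mem (hessian f x i j) := by
  rw [hessian_f_apply (Dbp_subset_distinctSet hx), hessBox]
  refine Ival.mem_sum _ fun p _ => Ival.mem_sum _ fun q hq => Ival.mem_sum _ fun s _ =>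
    Ival.mem_sum _ fun t _ => ?_
  split_ifs
  · exact (pairBox_holds hx (Finset.mem_Ioi.1 hq)).hess t s
  · exact Ival.mem_zero

/-- The enclosure of the Hessian matrix is contained in the prescribed intervals, even after these
are shrunk to multiples of `10⁻⁶`. -/
theorem hessBox_check : ∀ i j, (hessFloor i j + 1 : ℚ) ≤ 10 ^ 6 * (hessBox i j).lo ∧
    10 ^ 6 * (hessBox i j).hi ≤ (hessCeil i j - 1 : ℚ) := by
  decide +kernel

/-! ### The maximum of the distance sum -/

theorem hessian_mem_intervalHessian {x : Fin 7 → ℝ} (hx : x ∈ Dbp) :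
    hessian f x ∈ intervalHessian := by
  refine ⟨?_, fun i j => ?_⟩
  · ext i j
    rw [Matrix.transpose_apply, hessian_f_apply (Dbp_subset_distinctSet hx),
      hessian_f_apply (Dbp_subset_distinctSet hx)]
    refine Finset.sum_congr rfl fun p _ => Finset.sum_congr rfl fun q _ => ?_
    rw [Finset.sum_comm]
    refine Finset.sum_congr rfl fun s _ => Finset.sum_congr rfl fun t _ => ?_
    exact if_congr and_comm (chordHess_comm _ _ _) rfl
  · obtain ⟨h1, h2⟩ := mem_hessBox hx i j
    obtain ⟨c1, c2⟩ := hessBox_check i j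
    have c1' : (hessFloor i j + 1 : ℝ) ≤ 10 ^ 6 * (hessBox i j).lo := by exact_mod_cast c1
    have c2' : 10 ^ 6 * ((hessBox i j).hi : ℝ) ≤ hessCeil i j - 1 := by exact_mod_cast c2
    have b1 := (hessFloor_bounds i j).2
    have b2 := (hessCeil_bounds i j).1
    constructor <;> linarith

/-- A function with negative definite Hessian matrices on a convex set is strictly smaller than at
a critical point everywhere else: along a segment that starts in the critical point its derivative
is strictly decreasing and vanishes at the start. -/
theorem lt_of_hessian_negDef {g : (Fin 7 → ℝ) → ℝ} {S : Set (Fin 7 → ℝ)} (hS : Convex ℝ S)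
    (hg : ∀ x ∈ S, ContDiffAt ℝ 2 g x) (hH : ∀ x ∈ S, (-hessian g x).PosDef)
    {a x : Fin 7 → ℝ} (ha : a ∈ S) (hx : x ∈ S) (hcrit : fderiv ℝ g a = 0) (hne : x ≠ a) :
    g x < g a := by
  set v := x - a
  have hv : v ≠ 0 := sub_ne_zero.2 hne
  set γ : ℝ → Fin 7 → ℝ := fun t => a + t • v
  have hγS : ∀ t ∈ Set.Icc (0 : ℝ) 1, γ t ∈ S := fun t ht => hS.add_smul_sub_mem ha hx ht
  have hγ : ∀ t, HasDerivAt γ v t := fun t =>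
    (((hasDerivAt_id t).smul_const v).const_add a).congr_deriv (one_smul ℝ v)
  have h1 : ∀ t ∈ Set.Icc (0 : ℝ) 1, HasDerivAt (fun t => g (γ t)) (fderiv ℝ g (γ t) v) t :=
    fun t ht => ((hg _ (hγS t ht)).differentiableAt (by norm_num)).hasFDerivAt.comp_hasDerivAt t
      (hγ t)
  have h2 : ∀ t ∈ Set.Icc (0 : ℝ) 1, HasDerivAt (fun t => fderiv ℝ g (γ t) v)
      (∑ i, ∑ j, hessian g (γ t) i j * v i * v j) t := fun t ht => by
    have hd : DifferentiableAt ℝ (fderiv ℝ g) (γ t) :=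
      ((hg _ (hγS t ht)).fderiv_right (m := 1) (by norm_num)).differentiableAt (by norm_num)
    have h := (hd.hasFDerivAt.comp_hasDerivAt t (hγ t)).clm_apply (hasDerivAt_const t v)
    refine h.congr_deriv ?_
    have e : ∀ i j, hessian g (γ t) i j
        = fderiv ℝ (fderiv ℝ g) (γ t) (Pi.single i 1) (Pi.single j 1) := fun i j => by
      rw [hessian, Matrix.of_apply]
      have := (hd.hasFDerivAt.clm_apply (hasFDerivAt_const (Pi.single j (1 : ℝ)) (γ t))).fderiv
      rw [this]
      simp
    have hvs : v = ∑ i, v i • Pi.single i (1 : ℝ) := by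
      funext k
      simp [Finset.sum_apply, Pi.single_apply]
    simp only [e, map_zero, add_zero]
    conv_lhs => rw [hvs]
    simp only [map_sum, map_smul, sum_apply, smul_apply,
      smul_eq_mul, Finset.mul_sum]
    rw [Finset.sum_comm]
    refine Finset.sum_congr rfl fun i _ => Finset.sum_congr rfl fun j _ => by ring
  have hneg : ∀ t ∈ Set.Icc (0 : ℝ) 1, ∑ i, ∑ j, hessian g (γ t) i j * v i * v j < 0 :=
    fun t ht => by
      have h := (hH _ (hγS t ht)).dotProduct_mulVec_pos hv
      have e : star v ⬝ᵥ (-hessian g (γ t)).mulVec v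
          = -∑ i, ∑ j, hessian g (γ t) i j * v i * v j := by
        simp only [dotProduct, Matrix.mulVec, star_trivial, Matrix.neg_apply, Finset.mul_sum,
          ← Finset.sum_neg_distrib]
        exact Finset.sum_congr rfl fun i _ => Finset.sum_congr rfl fun j _ => by ring
      linarith
  have anti1 : StrictAntiOn (fun t => fderiv ℝ g (γ t) v) (Set.Icc 0 1) := by
    refine strictAntiOn_of_deriv_neg (convex_Icc 0 1)
      (fun t ht => (h2 t ht).continuousAt.continuousWithinAt) fun t ht => ?_
    rw [interior_Icc] at ht
    have ht' := Set.Ioo_subset_Icc_self ht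
    rw [(h2 t ht').deriv]
    exact hneg t ht'
  have anti0 : StrictAntiOn (fun t => g (γ t)) (Set.Icc 0 1) := by
    refine strictAntiOn_of_deriv_neg (convex_Icc 0 1)
      (fun t ht => (h1 t ht).continuousAt.continuousWithinAt) fun t ht => ?_
    rw [interior_Icc] at ht
    have ht' := Set.Ioo_subset_Icc_self ht
    rw [(h1 t ht').deriv]
    have h := anti1 (Set.left_mem_Icc.2 zero_le_one) ht' ht.1
    simpa [γ, hcrit] using h
  have h := anti0 (Set.left_mem_Icc.2 zero_le_one) (Set.right_mem_Icc.2 zero_le_one) zero_lt_one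
  simpa [γ, v] using h

theorem mem_Dbp_of_abs_le {x : Fin 7 → ℝ} (h : ∀ i, |x i - thetaBp i| ≤ Real.pi / 377) :
    x ∈ Dbp := by
  have p1 := Real.pi_gt_d20
  have p2 := Real.pi_lt_d20
  rw [Dbp, Set.mem_Icc, Pi.le_def, Pi.le_def, ← forall_and]
  intro i
  obtain ⟨h1, h2⟩ := abs_le.1 (h i)
  fin_cases i <;> simp [boxLower, boxUpper, thetaBp] at h1 h2 ⊢ <;> constructor <;> linarith

theorem thetaBp_mem_Dbp : thetaBp ∈ Dbp :=
  mem_Dbp_of_abs_le fun i => by simpa using div_nonneg Real.pi_pos.le (by norm_num)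

theorem fmax_eq : fmax = 3 * √3 + 6 * √2 + 2 := by
  have h4 : √(4 : ℝ) = 2 := by
    rw [show (4 : ℝ) = 2 ^ 2 by norm_num]; exact Real.sqrt_sq (by norm_num)
  have h3 : √(3 : ℝ) * √3 = 3 := Real.mul_self_sqrt (by norm_num)
  have c1 : Real.cos (Real.pi + Real.pi / 2) = 0 := by simp [Real.cos_add]
  have c2 : Real.cos (-(Real.pi / 2) - Real.pi / 2) = -1 := by
    rw [show -(Real.pi / 2) - Real.pi / 2 = -Real.pi by ring]; simp
  have e1 : -2⁻¹ + 2 + 2 * (√(3 : ℝ) / 2) * (√3 / 2) = 3 := by linear_combination 1 / 2 * h3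
  rw [fmax, f_eq]
  simp [thetaBp, c1, c2]
  rw [e1]
  norm_num [h4]
  ring

theorem fderiv_f_thetaBp : fderiv ℝ f thetaBp = 0 := by
  have hd := Dbp_subset_distinctSet thetaBp_mem_Dbp
  have e1 : Finset.Ioi (0 : Fin 5) = {1, 2, 3, 4} := by decide
  have e2 : Finset.Ioi (1 : Fin 5) = {2, 3, 4} := by decide
  have e3 : Finset.Ioi (2 : Fin 5) = {3, 4} := by decide
  have e4 : Finset.Ioi (3 : Fin 5) = {4} := by decide
  have e5 : Finset.Ioi (4 : Fin 5) = ∅ := by decide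
  have h3 : √(3 : ℝ) * √3 = 3 := Real.mul_self_sqrt (by norm_num)
  have s1 : Real.sin (-(Real.pi / 2) - Real.pi / 2) = 0 := by
    rw [show -(Real.pi / 2) - Real.pi / 2 = -Real.pi by ring]; simp
  have a1 : 2 - 2 * (2⁻¹ * 2⁻¹ + -(√(3 : ℝ) / 2 * (√3 / 2))) = 3 := by
    linear_combination 1 / 2 * h3
  have a2 : (2 + 1 : ℝ) = 3 := by norm_num
  refine ContinuousLinearMap.ext fun v => ?_
  rw [fderiv_f_apply hd, Fin.sum_univ_five, e1, e2, e3, e4, e5]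
  simp [pairCoord_eq, latitude, longitude, thetaBp, chordGrad, chord, cosAngleGrad, cosAngle,
    pairLinear, pairIndex, coordIndex, Fin.sum_univ_four, s1, a1, a2]
  ring

end FivePoints

theorem mainTheorem2 :
    -- the box contains the cube of radius `π / 377` about the bipyramid coordinates
    (∀ x : Fin 7 → ℝ, (∀ i, |x i - FivePoints.thetaBp i| ≤ Real.pi / 377) →
        x ∈ FivePoints.Dbp) ∧
    -- `f` is twice continuously differentiable at every point of the box, and its
    -- Hessian matrix over the box varies in the interval Hessian matrix
    (∀ x ∈ FivePoints.Dbp, ContDiffAt ℝ 2 FivePoints.f x ∧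
        FivePoints.hessian FivePoints.f x ∈ FivePoints.intervalHessian) ∧
    -- the interval Hessian matrix is negative definite
    FivePoints.IsNegDef FivePoints.intervalHessian ∧
    -- the bipyramid coordinates are the only maximiser of `f` on the box
    FivePoints.thetaBp ∈ FivePoints.Dbp ∧
    (∀ x ∈ FivePoints.Dbp, FivePoints.f x ≤ FivePoints.fmax ∧
        (FivePoints.f x = FivePoints.fmax ↔ x = FivePoints.thetaBp)) ∧
    FivePoints.fmax = 3 * √3 + 6 * √2 + 2 := by
  open FivePoints in
  have hC : ∀ x ∈ Dbp, ContDiffAt ℝ 2 f x := fun x hx => contDiffAt_f (Dbp_subset_distinctSet hx)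
  refine ⟨fun x => mem_Dbp_of_abs_le, fun x hx => ⟨hC x hx, hessian_mem_intervalHessian hx⟩,
    isNegDef_intervalHessian, thetaBp_mem_Dbp, fun x hx => ?_, fmax_eq⟩
  have hlt : x ≠ thetaBp → f x < fmax :=
    lt_of_hessian_negDef (convex_Icc _ _) hC
      (fun y hy => isNegDef_intervalHessian _ (hessian_mem_intervalHessian hy))
      thetaBp_mem_Dbp hx fderiv_f_thetaBp
  refine ⟨?_, fun h => ?_, fun h => h ▸ rfl⟩
  · by_cases h : x = thetaBp
    · exact (h ▸ rfl : f x = fmax).le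
    · exact (hlt h).le
  · by_contra hne
    exact (hlt hne).ne h
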